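/- Let $n\in\{2,3\}$, $r\ge 1$, $\sigma>0$, $\nu>0$. There is a constant $C>0$, depending only on $n,r,\sigma,\nu$ (in particular independent of the mesh sizes $h$, $H$ and of $H/h$), such that the following holds. Let $D\subset\mathbb R^n$ be a bounded open set, let $K_1\subset\overline D$ be closed, $K_2=D\setminus K_1$ and $\Gamma=\partial K_1\setminus\partial D$. Let $\mathcal T_h$ and $\mathcal T_H$ be conforming (face-to-face) simplicial triangulations of $K_1$ and $\overline{K_2}$ that need not match across $\Gamma$. Write $h_\tau$ for the diameter of a closed simplex $\tau$ and assume that every $\tau\in\mathcal T_h\cup\mathcal T_H$ contains a ball of diameter at least $h_\tau/\sigma$. Let $\mathcal E_h$ and $\mathcal E_H$ be the sets of edges ($n=2$) or faces ($n=3$) of $\mathcal T_h$ and of $\mathcal T_H$ that lie in $\overline\Gamma$, and assume that each of these two sets covers $\Gamma$. Let $\mathcal E_\cap$ be the set of all $(n-1)$-dimensional intersections $e\cap E$ with $e\in\mathcal E_h$, $E\in\mathcal E_H$. Let $\mathcal T_h^\Gamma$ and $\mathcal T_H^\Gamma$ be the sets of closed simplices $\tau$ in $\mathcal T_h$ and in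 $\mathcal T_H$ with $\tau\cap\Gamma\ne\emptyset$, and $\mathcal T_{h,H}^\Gamma=\mathcal T_h^\Gamma\cup\mathcal T_H^\Gamma$. For $e\in\mathcal E_\cap$ let $h_e=h_{\tau_1}$, where $\tau_1$ is the simplex of $\mathcal T_h$ containing $e$. Assume: (A) $h_\tau\ge\nu h_\Gamma$ for all $\tau\in\mathcal T_h^\Gamma$, where $h_\Gamma=\max\{h_\tau:\tau\in\mathcal T_h^\Gamma\}$; (B) $\mathcal E_\cap=\mathcal E_h$. Let $X_h$ (respectively $X_H$) be the space of continuous functions on $K_1$ (respectively $\overline{K_2}$) whose restriction to each simplex of $\mathcal T_h$ (respectively $\mathcal T_H$) is a polynomial of degree at most $r$. Let $X_{h,H}=X_h\times X_H$, and identify $v=(v_1,v_2)\in X_{h,H}$ with the function on $D$ that equals $v_1$ on $K_1\cap D$ and $v_2$ on $K_2$. On $\Gamma$ write $[v]=v_1-v_2$. Then there is a linear map $E_h:X_{h,H}\to X_{h,H}\cap H^1(D)$ such that, for all $v\in X_{h,H}$ and all integers $0\le m\le r$, $$\sum_{\tau\in\mathcal T_{h,H}^\Gamma}h_\tau^{2m-2}\,|v-E_hv|_{m,\tau}^2\;\le\;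 C\sum_{e\in\mathcal E_\cap}h_e^{-1}\,\|[v]\|_{0,e}^2 .$$ Here $|w|_{m,\tau}^2=\sum_{|\alpha|=m}\|\partial^\alpha w\|_{L^2(\tau)}^2$, where $w$ is taken on $\tau$ as the polynomial given by its $X_h$- or $X_H$-component, and $\|\cdot\|_{0,e}$ is the $L^2(e)$ norm for the $(n-1)$-dimensional surface measure. -/

import Mathlib

open scoped MeasureTheory ContDiff

namespace NitscheHybrid

/-- A conforming simplicial triangulation in `ℝⁿ`: a finite family of nondegenerate `n`-simplices,
each given by its `n + 1` vertices, any two of which meet in a common (possibly empty) face. -/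
structure Triangulation (n : ℕ) where
  cells : Finset (Finset (EuclideanSpace ℝ (Fin n)))
  card_eq : ∀ s ∈ cells, s.card = n + 1
  indep : ∀ s ∈ cells, AffineIndependent ℝ ((↑) : s → EuclideanSpace ℝ (Fin n))
  inter_eq : ∀ s ∈ cells, ∀ t ∈ cells,
    convexHull ℝ (s : Set (EuclideanSpace ℝ (Fin n))) ∩ convexHull ℝ (t : Set _) =
      convexHull ℝ ((s : Set _) ∩ (t : Set _))

/-- The closed simplex with vertex set `s`. -/
def hull {n : ℕ} (s : Finset (EuclideanSpace ℝ (Fin n))) : Set (EuclideanSpace ℝ (Fin n)) :=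
  convexHull ℝ (s : Set (EuclideanSpace ℝ (Fin n)))

/-- The size `h_τ` of a simplex: its diameter. -/
noncomputable def size {n : ℕ} (s : Finset (EuclideanSpace ℝ (Fin n))) : ℝ :=
  Metric.diam (hull s)

namespace Triangulation

variable {n : ℕ}

/-- The closed region covered by the triangulation. -/
def support (T : Triangulation n) : Set (EuclideanSpace ℝ (Fin n)) :=
  ⋃ s ∈ T.cells, hull s

/-- Shape regularity with parameter `σ`: every simplex `τ` contains a ball of some diameter
`2 ρ > 0` with `h_τ ≤ σ * (2 ρ)`. -/
def ShapeRegular (T : Triangulation n) (σ : ℝ) : Prop :=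
  ∀ s ∈ T.cells, ∃ (c : EuclideanSpace ℝ (Fin n)) (ρ : ℝ),
    0 < ρ ∧ Metric.closedBall c ρ ⊆ hull s ∧ size s ≤ σ * (2 * ρ)

/-- The Lagrange finite element space of degree `r`: functions on the region covered by `T` that
are continuous there and whose restriction to every simplex is a polynomial of total degree at
most `r`. Such a function is represented by its extension by zero to `ℝⁿ`, so that an element of
the space is determined by its values on the region. -/
def lagrange (T : Triangulation n) (r : ℕ) :
    Submodule ℝ (EuclideanSpace ℝ (Fin n) → ℝ) where
  carrier := {v | ContinuousOn v T.support ∧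
    (∀ s ∈ T.cells, ∃ p : MvPolynomial (Fin n) ℝ, p.totalDegree ≤ r ∧
      ∀ x ∈ hull s, v x = MvPolynomial.eval (fun i => x i) p) ∧
    ∀ x ∉ T.support, v x = 0}
  add_mem' := by
    rintro v w ⟨hv, hv', hv''⟩ ⟨hw, hw', hw''⟩
    refine ⟨hv.add hw, fun s hs => ?_, fun x hx => by simp [hv'' x hx, hw'' x hx]⟩
    obtain ⟨p, hp, hpv⟩ := hv' s hs
    obtain ⟨q, hq, hqw⟩ := hw' s hs
    exact ⟨p + q, (MvPolynomial.totalDegree_add p q).trans (max_le hp hq),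
      fun x hx => by simp [hpv x hx, hqw x hx]⟩
  zero_mem' := ⟨continuousOn_const, fun s _ => ⟨0, by simp, fun x _ => by simp⟩, fun x _ => rfl⟩
  smul_mem' := by
    rintro c v ⟨hv, hv', hv''⟩
    refine ⟨hv.const_smul c, fun s hs => ?_, fun x hx => by simp [hv'' x hx]⟩
    obtain ⟨p, hp, hpv⟩ := hv' s hs
    exact ⟨c • p, (MvPolynomial.totalDegree_smul_le c p).trans hp,
      fun x hx => by simp [hpv x hx, MvPolynomial.smul_eval]⟩

open Classical in
/-- The edges (`n = 2`) or faces (`n = 3`) of `T` that lie on the interface `Γ`, i.e. in its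
closure, as vertex sets. -/
noncomputable def interfaceFaces (T : Triangulation n) (Γ : Set (EuclideanSpace ℝ (Fin n))) :
    Finset (Finset (EuclideanSpace ℝ (Fin n))) :=
  (T.cells.biUnion fun s => s.powersetCard n).filter fun e => hull e ⊆ closure Γ

open Classical in
/-- The simplices of `T` that touch `Γ`. -/
noncomputable def interfaceCells (T : Triangulation n) (Γ : Set (EuclideanSpace ℝ (Fin n))) :
    Finset (Finset (EuclideanSpace ℝ (Fin n))) :=
  T.cells.filter fun s => (hull s ∩ Γ).Nonempty

end Triangulation

section Interface

variable {n : ℕ}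

/-- The interface `Γ = ∂K₁ \ ∂D`, where `K₁` is the region covered by the fine mesh. -/
def interface (D : Set (EuclideanSpace ℝ (Fin n))) (Th : Triangulation n) :
    Set (EuclideanSpace ℝ (Fin n)) :=
  frontier Th.support \ frontier D

/-- `Th` triangulates a closed subregion `K₁` of (the closure of) the open set `D`, `TH`
triangulates (the closure of) `K₂ = D \ K₁`, and both meshes are fitted to the interface `Γ`:
it is covered by faces of `Th` lying on it, and also by faces of `TH` lying on it. Nothing relates
the two meshes across `Γ`. -/
structure IsHybridMesh (D : Set (EuclideanSpace ℝ (Fin n))) (Th TH : Triangulation n) :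
    Prop where
  isOpen : IsOpen D
  support_subset : Th.support ⊆ closure D
  closure_diff : closure (D \ Th.support) = TH.support
  fitted_h : interface D Th ⊆ ⋃ e ∈ Th.interfaceFaces (interface D Th), hull e
  fitted_H : interface D Th ⊆ ⋃ e ∈ TH.interfaceFaces (interface D Th), hull e

open Classical in
/-- The intersected interface mesh `{e ∩ E}`, with `e` and `E` the interface faces of the two
meshes; only the genuinely `(n-1)`-dimensional intersections are kept. -/
noncomputable def cutMesh (D : Set (EuclideanSpace ℝ (Fin n))) (Th TH : Triangulation n) :
    Finset (Set (EuclideanSpace ℝ (Fin n))) :=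
  ((Th.interfaceFaces (interface D Th) ×ˢ TH.interfaceFaces (interface D Th)).image
    fun q => hull q.1 ∩ hull q.2).filter fun e => μHE[n - 1] e ≠ 0

/-- The fine mesh is quasi-uniform near the interface, with constant `ν`: `h_τ ≥ ν h_Γ` for every
fine simplex `τ` that touches `Γ`, where `h_Γ` is the largest size of such a simplex. -/
def QuasiUniformNear (D : Set (EuclideanSpace ℝ (Fin n))) (Th : Triangulation n) (ν : ℝ) : Prop :=
  ∀ s ∈ Th.interfaceCells (interface D Th),
    ν * sSup {d | ∃ t ∈ Th.interfaceCells (interface D Th), d = size t} ≤ size s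

open Classical in
/-- The fine interface mesh is a subgrid of the coarse one: the intersected interface mesh is the
fine interface mesh. -/
def IsSubgrid (D : Set (EuclideanSpace ℝ (Fin n))) (Th TH : Triangulation n) : Prop :=
  cutMesh D Th TH = (Th.interfaceFaces (interface D Th)).image hull

/-- `h_e` for a piece `e` of the intersected interface mesh: the size of the simplex of `T` whose
boundary contains `e` (there is only one, since `e` lies in the boundary of the region covered
by `T`). -/
noncomputable def adjacentSize (T : Triangulation n) (e : Set (EuclideanSpace ℝ (Fin n))) : ℝ :=
  sSup {d | ∃ s ∈ T.cells, e ⊆ hull s ∧ d = size s}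

open Classical in
/-- The function on `D` that is `v₁` on `K₁` and `v₂` on `D \ K₁`. -/
noncomputable def glue (Th : Triangulation n) (v₁ v₂ : EuclideanSpace ℝ (Fin n) → ℝ) :
    EuclideanSpace ℝ (Fin n) → ℝ :=
  fun x => if x ∈ Th.support then v₁ x else v₂ x

/-- `f ∈ H¹(D)`: `f ∈ L²(D)` and all its first order weak derivatives exist in `L²(D)`. -/
def MemH1 (D : Set (EuclideanSpace ℝ (Fin n))) (f : EuclideanSpace ℝ (Fin n) → ℝ) : Prop :=
  MeasureTheory.MemLp f 2 (MeasureTheory.volume.restrict D) ∧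
  ∀ i : Fin n, ∃ g : EuclideanSpace ℝ (Fin n) → ℝ,
    MeasureTheory.MemLp g 2 (MeasureTheory.volume.restrict D) ∧
    ∀ φ : EuclideanSpace ℝ (Fin n) → ℝ, ContDiff ℝ ∞ φ → HasCompactSupport φ → tsupport φ ⊆ D →
      ∫ x in D, f x * fderiv ℝ φ x (EuclideanSpace.single i 1) = -∫ x in D, g x * φ x

open Classical in
/-- The square of the Sobolev seminorm `|w|_{m,τ}` of a function that is smooth inside the
simplex `τ`: the sum over all multi-indices `α` with `|α| = m` of the squared `L²(τ)` norms
of `∂^α w`. The multi-indices are listed as the nondecreasing `m`-tuples of coordinate indices. -/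
noncomputable def seminormSq (m : ℕ) (s : Finset (EuclideanSpace ℝ (Fin n)))
    (w : EuclideanSpace ℝ (Fin n) → ℝ) : ℝ :=
  ∑ α ∈ Finset.univ.filter (fun α : Fin m → Fin n => Monotone α),
    ∫ x in interior (hull s),
      (iteratedFDeriv ℝ m w x fun j => EuclideanSpace.single (α j) (1 : ℝ)) ^ 2

end Interface

end NitscheHybrid

/-! Only the fine component has to be changed. Since the fine interface mesh is a subgrid of the
coarse one, every fine interface face lies in a single coarse simplex, so the jump is there one
polynomial of degree at most $r$ and is determined by its values at the principal lattice points of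
the face. `conformingMap` subtracts from $v_1$ the finite element function with these jump values at
the lattice points on interface faces and zero at all others, and keeps $v_2$. The two components
then agree on $\Gamma$ (`conformingMap_fst_eq`). A point of $D$ common to both meshes lies on
$\Gamma$, so the glued function is a continuous piecewise polynomial on $D$, hence in $H^1(D)$
(`IsPiecewisePolynomial.memH1`).

The coarse part of the error is zero. On a fine simplex of size $h$ the error is a polynomial with
known nodal values, and three scalings combine. Barycentric gradients are bounded by $\sigma/h$,
which gives $|w|_{m,\tau}^2\lesssim h^{n-2m}Q$ for squared nodal values at most $Q$
(`exists_size_zpow_mul_seminormSq_le`). Equivalence of norms on a reference simplex, transported by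
barycentric coordinates, bounds a squared nodal value on a face $e$ by $h^{-(n-1)}\|[v]\|_{0,e}^2$
(`exists_sq_eval_le_integral_face`). With the weight $h^{2m-2}$ the total power is $h^{-1}$,
whatever $m$ is.

The face that supplies a nodal value need not belong to the cell under consideration.
Quasi-uniformity makes all sizes near the interface comparable with $h_\Gamma$, and a volume packing
argument bounds the number of cells that meet a given face (`card_cells_meeting_le`), so summing
over cells costs only a constant. -/

namespace NitscheHybrid

/-! ### Lagrange interpolation on the principal lattice, in barycentric coordinates -/

section Lattice

variable {ι : Type*}

open Classical in
/-- The multi-indices of weight `r` supported in `t`; they index both the Bernstein monomials and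
the Lagrange nodes of degree `r` of a simplex with vertex set `t`. -/
noncomputable def latticeIndices (t : Finset ι) (r : ℕ) : Finset (ι →₀ ℕ) :=
  Finset.finsuppAntidiag t r

theorem mem_latticeIndices {t : Finset ι} {r : ℕ} {α : ι →₀ ℕ} :
    α ∈ latticeIndices t r ↔ ∑ v ∈ t, α v = r ∧ α.support ⊆ t := by
  classical
  simp [latticeIndices, Finset.mem_finsuppAntidiag]

theorem latticeIndices_mono {s t : Finset ι} (h : s ⊆ t) (r : ℕ) :
    latticeIndices s r ⊆ latticeIndices t r := by
  classical
  exact Finset.finsuppAntidiag_mono h r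

theorem mem_latticeIndices_of_support_subset {s t : Finset ι} {r : ℕ} {α : ι →₀ ℕ}
    (hα : α ∈ latticeIndices t r) (hst : s ⊆ t) (hs : α.support ⊆ s) :
    α ∈ latticeIndices s r := by
  rw [mem_latticeIndices] at hα ⊢
  refine ⟨?_, hs⟩
  rw [← hα.1]
  refine Finset.sum_subset hst fun v _ hv => ?_
  by_contra h
  exact hv (hs (Finsupp.mem_support_iff.2 h))

theorem card_latticeIndices (t : Finset ι) (r : ℕ) :
    (latticeIndices t r).card = (t.card + r - 1).choose r := by
  classical
  exact Finset.card_finsuppAntidiag_nat_eq_choose r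

/-- The Lagrange shape function of degree `r` at the node with index `α`, as a function of the
barycentric coordinates. -/
noncomputable def shape (r : ℕ) (α : ι →₀ ℕ) (l : ι → ℝ) : ℝ :=
  ∏ v ∈ α.support, ∏ j ∈ Finset.range (α v), ((r : ℝ) * l v - j) / (j + 1)

/-- The barycentric coordinates of the lattice node with index `α`. -/
noncomputable def nodeCoord (r : ℕ) (α : ι →₀ ℕ) : ι → ℝ := fun v => (α v : ℝ) / r

theorem prod_range_sub_div (a : ℕ) :
    ∏ j ∈ Finset.range a, ((a : ℝ) - j) / (j + 1) = 1 := by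
  rw [Finset.prod_div_distrib, div_eq_one_iff_eq, ← Finset.prod_range_reflect]
  · refine Finset.prod_congr rfl fun j hj => ?_
    have hj := Finset.mem_range.1 hj
    rw [Nat.sub_sub, Nat.cast_sub (by omega)]
    push_cast
    ring
  · exact Finset.prod_ne_zero_iff.2 fun j _ => by positivity

/-- One linear factor vanishes. With `j = β v` this gives zero at the other lattice nodes; with `j =
0` it gives zero on every face that omits a vertex in the support of `α`. -/
theorem shape_eq_zero {r : ℕ} {α : ι →₀ ℕ} {l : ι → ℝ} {v : ι} {j : ℕ} (hj : j < α v)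
    (h : (r : ℝ) * l v = j) : shape r α l = 0 := by
  refine Finset.prod_eq_zero (i := v) (Finsupp.mem_support_iff.2 (by omega)) ?_
  exact Finset.prod_eq_zero (Finset.mem_range.2 hj) (by rw [h]; simp)

theorem shape_nodeCoord_self {r : ℕ} (hr : 1 ≤ r) (α : ι →₀ ℕ) :
    shape r α (nodeCoord r α) = 1 := by
  refine Finset.prod_eq_one fun v _ => ?_
  refine (Finset.prod_congr rfl fun j _ => ?_).trans (prod_range_sub_div (α v))
  have : (r : ℝ) ≠ 0 := by positivity
  rw [nodeCoord, mul_div_cancel₀ _ this]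

/-- Two different multi-indices of the same weight cannot satisfy `α ≤ β`, so some coordinate of `β`
is smaller than that of `α`, and the corresponding factor vanishes. -/
theorem shape_nodeCoord_of_ne {t : Finset ι} {r : ℕ} (hr : 1 ≤ r) {α β : ι →₀ ℕ}
    (hα : α ∈ latticeIndices t r) (hβ : β ∈ latticeIndices t r) (h : α ≠ β) :
    shape r α (nodeCoord r β) = 0 := by
  have hr0 : (r : ℝ) ≠ 0 := by positivity
  obtain ⟨v, hv⟩ : ∃ v, β v < α v := by
    by_contra! hle
    apply h
    rw [mem_latticeIndices] at hα hβ
    have := (Finset.sum_eq_sum_iff_of_le (s := t) fun v _ => hle v).1 (hα.1.trans hβ.1.symm)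
    ext v
    by_cases hvt : v ∈ t
    · exact this v hvt
    · rw [Finsupp.notMem_support_iff.1 fun h => hvt (hα.2 h),
        Finsupp.notMem_support_iff.1 fun h => hvt (hβ.2 h)]
  exact shape_eq_zero hv (by rw [nodeCoord, mul_div_cancel₀ _ hr0])

/-- The functions of the barycentric coordinates spanned by the monomials of degree `r`. -/
noncomputable def bernstein (t : Finset ι) (r : ℕ) : Submodule ℝ ((ι → ℝ) → ℝ) :=
  Submodule.span ℝ ((fun (β : ι →₀ ℕ) (l : ι → ℝ) => ∏ v ∈ t, l v ^ β v) '' latticeIndices t r)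

theorem mul_mem_bernstein {t : Finset ι} {a b : ℕ} {f g : (ι → ℝ) → ℝ}
    (hf : f ∈ bernstein t a) (hg : g ∈ bernstein t b) : f * g ∈ bernstein t (a + b) := by
  have : bernstein t a * bernstein t b ≤ bernstein t (a + b) := by
    rw [bernstein, bernstein, Submodule.span_mul_span, Submodule.span_le]
    rintro _ ⟨_, ⟨α, hα, rfl⟩, _, ⟨β, hβ, rfl⟩, rfl⟩
    refine Submodule.subset_span ⟨α + β, ?_, ?_⟩
    · rw [Finset.mem_coe, mem_latticeIndices] at *
      refine ⟨by simp [Finset.sum_add_distrib, hα.1, hβ.1], ?_⟩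
      intro v hv
      by_contra hvt
      rw [Finsupp.mem_support_iff, Finsupp.add_apply,
        Finsupp.notMem_support_iff.1 fun h => hvt (hα.2 h),
        Finsupp.notMem_support_iff.1 fun h => hvt (hβ.2 h)] at hv
      exact hv rfl
    · ext l
      simp [pow_add, Finset.prod_mul_distrib]
  exact this (Submodule.mul_mem_mul hf hg)

theorem one_mem_bernstein (t : Finset ι) : (1 : (ι → ℝ) → ℝ) ∈ bernstein t 0 := by
  refine Submodule.subset_span ⟨0, ?_, ?_⟩
  · simp [mem_latticeIndices]
  · ext l; simp

theorem prod_mem_bernstein {κ : Type*} {t : Finset ι} (u : Finset κ) (a : κ → ℕ)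
    (f : κ → (ι → ℝ) → ℝ) (h : ∀ k ∈ u, f k ∈ bernstein t (a k)) :
    ∏ k ∈ u, f k ∈ bernstein t (∑ k ∈ u, a k) := by
  classical
  induction u using Finset.induction_on with
  | empty => simpa using one_mem_bernstein t
  | insert k u hk ih =>
    rw [Finset.prod_insert hk, Finset.sum_insert hk]
    exact mul_mem_bernstein (h k (by simp)) (ih fun j hj => h j (by simp [hj]))

theorem pow_mem_bernstein {t : Finset ι} {f : (ι → ℝ) → ℝ} (hf : f ∈ bernstein t 1) (k : ℕ) :
    f ^ k ∈ bernstein t k := by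
  simpa using prod_mem_bernstein (Finset.range k) (fun _ => 1) (fun _ => f) fun _ _ => hf

theorem coord_mem_bernstein {t : Finset ι} {v : ι} (hv : v ∈ t) :
    (fun l : ι → ℝ => l v) ∈ bernstein t 1 := by
  classical
  refine Submodule.subset_span ⟨Finsupp.single v 1, ?_, ?_⟩
  · rw [Finset.mem_coe, mem_latticeIndices]
    refine ⟨by simp [Finsupp.single_apply, hv], ?_⟩
    exact Finsupp.support_single_subset.trans (by simpa using hv)
  · ext l
    change ∏ w ∈ t, l w ^ Finsupp.single v 1 w = l v
    rw [Finset.prod_eq_single v]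
    · simp
    · intro w _ hw
      simp [Finsupp.single_eq_of_ne hw]
    · simp [hv]

theorem linear_mem_bernstein (t : Finset ι) (a : ι → ℝ) :
    (fun l : ι → ℝ => ∑ v ∈ t, l v * a v) ∈ bernstein t 1 := by
  have : (fun l : ι → ℝ => ∑ v ∈ t, l v * a v) = ∑ v ∈ t, a v • fun l : ι → ℝ => l v := by
    ext l; simp [mul_comm]
  rw [this]
  exact Submodule.sum_mem _ fun v hv => Submodule.smul_mem _ _ (coord_mem_bernstein hv)

/-- Where the coordinates sum to one, the constant `j` equals `j * ∑ w ∈ t, l w`. Each of the `r`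
affine factors thus becomes a linear form and the product becomes homogeneous. -/
theorem exists_shape_mem_bernstein {t : Finset ι} {r : ℕ} {α : ι →₀ ℕ}
    (hα : α ∈ latticeIndices t r) :
    ∃ f ∈ bernstein t r, ∀ l : ι → ℝ, ∑ v ∈ t, l v = 1 → f l = shape r α l := by
  rw [mem_latticeIndices] at hα
  have hsum : ∑ v ∈ α.support, α v = r := by
    rw [← hα.1]
    exact Finset.sum_subset hα.2 fun v _ hv => Finsupp.notMem_support_iff.1 hv
  refine ⟨∏ v ∈ α.support, ∏ j ∈ Finset.range (α v),
    ((r / (j + 1) : ℝ) • (fun l : ι → ℝ => l v) -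
      (j / (j + 1) : ℝ) • fun l : ι → ℝ => ∑ w ∈ t, l w * 1), ?_, ?_⟩
  · have := prod_mem_bernstein (t := t) α.support α (fun v => ∏ j ∈ Finset.range (α v),
      ((r / (j + 1) : ℝ) • (fun l : ι → ℝ => l v) -
      (j / (j + 1) : ℝ) • fun l : ι → ℝ => ∑ w ∈ t, l w * 1)) ?_
    · rwa [hsum] at this
    · intro v hv
      have := prod_mem_bernstein (t := t) (Finset.range (α v)) (fun _ => 1) (fun j =>
        ((r / (j + 1) : ℝ) • (fun l : ι → ℝ => l v) -
          (j / (j + 1) : ℝ) • fun l : ι → ℝ => ∑ w ∈ t, l w * 1)) fun j _ =>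
          Submodule.sub_mem _ (Submodule.smul_mem _ _ (coord_mem_bernstein (hα.2 hv)))
            (Submodule.smul_mem _ _ (linear_mem_bernstein t _))
      simpa using this
  · intro l hl
    simp only [Finset.prod_apply, shape, Pi.sub_apply, Pi.smul_apply, mul_one, hl, smul_eq_mul]
    refine Finset.prod_congr rfl fun v _ => Finset.prod_congr rfl fun j _ => ?_
    ring

theorem sum_nodeCoord {t : Finset ι} {r : ℕ} (hr : 1 ≤ r) {α : ι →₀ ℕ}
    (hα : α ∈ latticeIndices t r) : ∑ v ∈ t, nodeCoord r α v = 1 := by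
  have hr0 : (r : ℝ) ≠ 0 := by positivity
  simp only [nodeCoord]
  rw [← Finset.sum_div, ← Nat.cast_sum, (mem_latticeIndices.1 hα).1, div_self hr0]

/-- Lagrange interpolation on the principal lattice of order `r` reproduces the polynomials of
degree `r`. -/
theorem eq_sum_shape {t : Finset ι} {r : ℕ} (hr : 1 ≤ r) {q : (ι → ℝ) → ℝ}
    (hq : q ∈ bernstein t r) {l : ι → ℝ} (hl : ∑ v ∈ t, l v = 1) :
    q l = ∑ α ∈ latticeIndices t r, q (nodeCoord r α) * shape r α l := by
  classical
  let I := latticeIndices t r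
  choose! f hf hfs using fun (α : ι →₀ ℕ) (hα : α ∈ I) => exists_shape_mem_bernstein hα
  have hfd : bernstein t r = Submodule.span ℝ
      ((I.image fun (β : ι →₀ ℕ) (l : ι → ℝ) => ∏ v ∈ t, l v ^ β v : Finset _) :
        Set ((ι → ℝ) → ℝ)) := by
    rw [bernstein, Finset.coe_image]
  have : FiniteDimensional ℝ (bernstein t r) := by
    rw [hfd]; infer_instance
  -- Dimension count: the space is spanned by at most `I.card` monomials, and evaluation at the
  -- `I.card` nodes is onto because the shape functions are dual to the nodes. Hence evaluation is
  -- injective, and nodal values determine `q`.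
  have hrank : Module.finrank ℝ (bernstein t r) ≤ I.card := by
    rw [hfd]
    exact (finrank_span_finset_le_card _).trans Finset.card_image_le
  let ev : bernstein t r →ₗ[ℝ] (I → ℝ) :=
    { toFun := fun p α => p.1 (nodeCoord r α.1)
      map_add' := fun _ _ => rfl
      map_smul' := fun _ _ => rfl }
  have hfev : ∀ α ∈ I, ∀ β ∈ I, f α (nodeCoord r β) = if α = β then 1 else 0 := by
    intro α hα β hβ
    rw [hfs α hα _ (sum_nodeCoord hr hβ)]
    split_ifs with h
    · rw [h, shape_nodeCoord_self hr]
    · exact shape_nodeCoord_of_ne hr hα hβ h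
  have hsurj : Function.Surjective ev := by
    intro c
    refine ⟨∑ α : I, c α • ⟨f α.1, hf α.1 α.2⟩, ?_⟩
    ext β
    simp only [map_sum, map_smul, Finset.sum_apply, Pi.smul_apply, smul_eq_mul]
    rw [Finset.sum_eq_single β]
    · have : ev ⟨f β.1, hf β.1 β.2⟩ β = 1 := by
        change f β.1 (nodeCoord r β.1) = 1
        rw [hfev _ β.2 _ β.2, if_pos rfl]
      rw [this, mul_one]
    · intro α _ hne
      have : ev ⟨f α.1, hf α.1 α.2⟩ β = 0 := by
        change f α.1 (nodeCoord r β.1) = 0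
        rw [hfev _ α.2 _ β.2, if_neg fun h => hne (Subtype.ext h)]
      rw [this, mul_zero]
    · simp
  have hker : LinearMap.ker ev = ⊥ := by
    have h := LinearMap.finrank_range_add_finrank_ker ev
    rw [LinearMap.range_eq_top.2 hsurj, finrank_top, Module.finrank_fintype_fun_eq_card,
      Fintype.card_coe] at h
    exact Submodule.finrank_eq_zero.1 (by omega)
  have hsum : (∑ α ∈ I, q (nodeCoord r α) • f α) ∈ bernstein t r :=
    Submodule.sum_mem _ fun α hα => Submodule.smul_mem _ _ (hf α hα)
  have heq : (⟨q, hq⟩ : bernstein t r) = ⟨_, hsum⟩ := by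
    apply LinearMap.ker_eq_bot.1 hker
    ext β
    change q (nodeCoord r β.1) = (∑ α ∈ I, q (nodeCoord r α) • f α) (nodeCoord r β.1)
    rw [Finset.sum_apply, Finset.sum_eq_single β.1]
    · simp [hfev _ β.2 _ β.2]
    · intro α hα hne
      simp [hfev _ hα _ β.2, hne]
    · exact fun h => absurd β.2 h
  have := congrFun (congrArg Subtype.val heq) l
  simp only [Finset.sum_apply, Pi.smul_apply, smul_eq_mul] at this
  rw [this]
  exact Finset.sum_congr rfl fun α hα => by rw [hfs α hα l hl]

/-- A polynomial of degree at most `r`, written in barycentric coordinates, is homogeneous of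
degree `r` in them. -/
theorem exists_bernstein_of_totalDegree_le {κ : Type*} (t : Finset ι) {r : ℕ}
    (u : ι → κ → ℝ) {p : MvPolynomial κ ℝ} (hp : p.totalDegree ≤ r) :
    ∃ f ∈ bernstein t r, ∀ l : ι → ℝ, ∑ v ∈ t, l v = 1 →
      f l = MvPolynomial.eval (fun i => ∑ v ∈ t, l v * u v i) p := by
  -- A monomial of degree below `r` is homogenized by the missing power of the form `∑ v ∈ t, l v`,
  -- which equals one on the hyperplane considered.
  refine ⟨∑ d ∈ p.support, p.coeff d • ((∏ i ∈ d.support,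
      (fun l : ι → ℝ => ∑ v ∈ t, l v * u v i) ^ d i) *
      (fun l : ι → ℝ => ∑ v ∈ t, l v * 1) ^ (r - ∑ i ∈ d.support, d i)), ?_, ?_⟩
  · refine Submodule.sum_mem _ fun d hd => Submodule.smul_mem _ _ ?_
    have hle : ∑ i ∈ d.support, d i ≤ r := (MvPolynomial.le_totalDegree hd).trans hp
    have := mul_mem_bernstein
      (prod_mem_bernstein d.support d _ fun i _ =>
        pow_mem_bernstein (linear_mem_bernstein t fun v => u v i) (d i))
      (pow_mem_bernstein (linear_mem_bernstein t fun _ => 1) (r - ∑ i ∈ d.support, d i))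
    rwa [Nat.add_sub_cancel' hle] at this
  · intro l hl
    rw [MvPolynomial.eval_eq]
    simp [Finset.sum_apply, Finset.prod_apply, hl]

theorem eval_eq_sum_shape {κ : Type*} (t : Finset ι) {r : ℕ} (hr : 1 ≤ r)
    (u : ι → κ → ℝ) {p : MvPolynomial κ ℝ} (hp : p.totalDegree ≤ r) {l : ι → ℝ}
    (hl : ∑ v ∈ t, l v = 1) :
    MvPolynomial.eval (fun i => ∑ v ∈ t, l v * u v i) p =
      ∑ α ∈ latticeIndices t r,
        MvPolynomial.eval (fun i => ∑ v ∈ t, nodeCoord r α v * u v i) p * shape r α l := by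
  obtain ⟨f, hf, hfe⟩ := exists_bernstein_of_totalDegree_le t u hp
  rw [← hfe l hl, eq_sum_shape hr hf hl]
  exact Finset.sum_congr rfl fun α hα => by rw [hfe _ (sum_nodeCoord hr hα)]

/-- There are `r` factors in all, and each is at most `r` in absolute value since `0 ≤ j ≤ r` and
the coordinates lie in the unit interval. -/
theorem abs_shape_le {t : Finset ι} {r : ℕ} (hr : 1 ≤ r) {α : ι →₀ ℕ}
    (hα : α ∈ latticeIndices t r) {l : ι → ℝ} (h0 : ∀ v ∈ t, 0 ≤ l v) (h1 : ∀ v ∈ t, l v ≤ 1) :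
    |shape r α l| ≤ (r : ℝ) ^ r := by
  rw [mem_latticeIndices] at hα
  have hsum : ∑ v ∈ α.support, α v = r := by
    rw [← hα.1]
    exact Finset.sum_subset hα.2 fun v _ hv => Finsupp.notMem_support_iff.1 hv
  have hr1 : (1 : ℝ) ≤ r := by exact_mod_cast hr
  rw [shape, Finset.abs_prod]
  calc _ ≤ ∏ v ∈ α.support, (r : ℝ) ^ α v := by
        refine Finset.prod_le_prod (fun _ _ => abs_nonneg _) fun v hv => ?_
        rw [Finset.abs_prod]
        have : (r : ℝ) ^ α v = ∏ j ∈ Finset.range (α v), (r : ℝ) := by simp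
        rw [this]
        refine Finset.prod_le_prod (fun _ _ => abs_nonneg _) fun j hj => ?_
        have hj : (j : ℝ) ≤ r := by
          have h2 : α v ≤ r := hsum ▸ Finset.single_le_sum (f := α) (fun _ _ => Nat.zero_le _) hv
          have := Finset.mem_range.1 hj
          exact_mod_cast (by omega : j ≤ r)
        rw [abs_div, abs_of_pos (by positivity : (0 : ℝ) < j + 1), div_le_iff₀ (by positivity),
          abs_le]
        have a0 := h0 v (hα.2 hv)
        have a1 := h1 v (hα.2 hv)
        have hj0 : (0 : ℝ) ≤ j := by positivity
        constructor <;> nlinarith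
    _ = (r : ℝ) ^ r := by rw [Finset.prod_pow_eq_pow_sum, hsum]

end Lattice
end NitscheHybrid
namespace NitscheHybrid

/-! ### Barycentric coordinates of simplices and their gradients -/

section Barycentric

variable {n : ℕ}

/-- The vertex set of a nondegenerate `n`-simplex in `ℝⁿ`. -/
def IsCell (s : Finset (EuclideanSpace ℝ (Fin n))) : Prop :=
  s.card = n + 1 ∧ AffineIndependent ℝ ((↑) : s → EuclideanSpace ℝ (Fin n))

theorem Triangulation.isCell (T : Triangulation n) {s : Finset (EuclideanSpace ℝ (Fin n))}
    (hs : s ∈ T.cells) : IsCell s :=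
  ⟨T.card_eq s hs, T.indep s hs⟩

open Classical in
theorem Triangulation.hull_inter (T : Triangulation n)
    {s t : Finset (EuclideanSpace ℝ (Fin n))} (hs : s ∈ T.cells) (ht : t ∈ T.cells) :
    hull s ∩ hull t = hull (s ∩ t) := by
  rw [hull, hull, hull, T.inter_eq s hs t ht, Finset.coe_inter]

theorem isCompact_hull (s : Finset (EuclideanSpace ℝ (Fin n))) : IsCompact (hull s) :=
  s.finite_toSet.isCompact_convexHull ℝ

theorem isClosed_hull (s : Finset (EuclideanSpace ℝ (Fin n))) : IsClosed (hull s) :=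
  (isCompact_hull s).isClosed

theorem convex_hull (s : Finset (EuclideanSpace ℝ (Fin n))) : Convex ℝ (hull s) :=
  convex_convexHull ℝ _

theorem hull_mono {s t : Finset (EuclideanSpace ℝ (Fin n))} (h : s ⊆ t) : hull s ⊆ hull t :=
  convexHull_mono (Finset.coe_subset.2 h)

theorem hull_subset_support (T : Triangulation n) {s : Finset (EuclideanSpace ℝ (Fin n))}
    (hs : s ∈ T.cells) : hull s ⊆ T.support :=
  Set.subset_biUnion_of_mem (u := fun s => hull s) hs

theorem mem_hull_iff {t : Finset (EuclideanSpace ℝ (Fin n))} {x : EuclideanSpace ℝ (Fin n)} :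
    x ∈ hull t ↔ ∃ w : EuclideanSpace ℝ (Fin n) → ℝ,
      (∀ v ∈ t, 0 ≤ w v) ∧ ∑ v ∈ t, w v = 1 ∧ ∑ v ∈ t, w v • v = x :=
  Finset.mem_convexHull'

theorem exists_barycentric {s : Finset (EuclideanSpace ℝ (Fin n))} (hs : IsCell s) :
    ∃ L : EuclideanSpace ℝ (Fin n) → (EuclideanSpace ℝ (Fin n) →ᵃ[ℝ] ℝ),
      (∀ v ∈ s, L v v = 1) ∧ ∀ u ∈ s, ∀ v ∈ s, v ≠ u → L v u = 0 := by
  classical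
  have htop : affineSpan ℝ (Set.range ((↑) : s → EuclideanSpace ℝ (Fin n))) = ⊤ := by
    rw [hs.2.affineSpan_eq_top_iff_card_eq_finrank_add_one]
    simp [hs.1]
  let b : AffineBasis s ℝ (EuclideanSpace ℝ (Fin n)) := ⟨(↑), hs.2, htop⟩
  have hb : ∀ v : s, b v = v.1 := fun _ => rfl
  refine ⟨fun v => if h : v ∈ s then b.coord ⟨v, h⟩ else 0, fun v hv => ?_,
    fun u hu v hv huv => ?_⟩
  · simp only [hv, dif_pos]
    exact b.coord_apply_eq ⟨v, hv⟩
  · simp only [hv, dif_pos]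
    exact b.coord_apply_ne (i := ⟨v, hv⟩) (j := ⟨u, hu⟩) fun h => huv (congrArg Subtype.val h)

open Classical in
/-- The barycentric coordinates of a nondegenerate simplex, as affine functions on `ℝⁿ`. -/
noncomputable def bary (s : Finset (EuclideanSpace ℝ (Fin n))) (v : EuclideanSpace ℝ (Fin n)) :
    EuclideanSpace ℝ (Fin n) →ᵃ[ℝ] ℝ :=
  if hs : IsCell s then (exists_barycentric hs).choose v else 0

theorem bary_self {s : Finset (EuclideanSpace ℝ (Fin n))} (hs : IsCell s)
    {v : EuclideanSpace ℝ (Fin n)} (hv : v ∈ s) : bary s v v = 1 := by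
  rw [bary, dif_pos hs]
  exact (exists_barycentric hs).choose_spec.1 v hv

theorem bary_of_ne {s : Finset (EuclideanSpace ℝ (Fin n))} (hs : IsCell s)
    {u v : EuclideanSpace ℝ (Fin n)} (hu : u ∈ s) (hv : v ∈ s) (h : v ≠ u) :
    bary s v u = 0 := by
  rw [bary, dif_pos hs]
  exact (exists_barycentric hs).choose_spec.2 u hu v hv h

theorem affineMap_sum_smul {V : Type*} [AddCommGroup V] [Module ℝ V] (A : V →ᵃ[ℝ] ℝ)
    {ι : Type*} (t : Finset ι) (w : ι → ℝ) (u : ι → V) (hw : ∑ i ∈ t, w i = 1) :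
    A (∑ i ∈ t, w i • u i) = ∑ i ∈ t, w i * A (u i) := by
  have h (x : V) : A x = A.linear x + A 0 := by
    simpa using A.map_vadd 0 x
  rw [h, map_sum]
  simp only [h (u _), mul_add, Finset.sum_add_distrib, ← Finset.sum_mul, hw, one_mul, map_smul,
    smul_eq_mul]

section Cell

variable {s t : Finset (EuclideanSpace ℝ (Fin n))} (hs : IsCell s) (hts : t ⊆ s)
  {v x : EuclideanSpace ℝ (Fin n)}
include hs hts

theorem bary_sum_smul {w : EuclideanSpace ℝ (Fin n) → ℝ} (hw : ∑ u ∈ t, w u = 1) (hv : v ∈ t) :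
    bary s v (∑ u ∈ t, w u • u) = w v := by
  rw [affineMap_sum_smul _ _ _ _ hw, Finset.sum_eq_single v]
  · rw [bary_self hs (hts hv), mul_one]
  · intro u hu huv
    rw [bary_of_ne hs (hts hu) (hts hv) huv.symm, mul_zero]
  · exact fun h => absurd hv h

theorem bary_eq_zero (hx : x ∈ hull t) (hv : v ∈ s) (hvt : v ∉ t) : bary s v x = 0 := by
  obtain ⟨w, -, hw, rfl⟩ := mem_hull_iff.1 hx
  rw [affineMap_sum_smul _ _ _ _ hw]
  refine Finset.sum_eq_zero fun u hu => ?_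
  rw [bary_of_ne hs (hts hu) hv (fun h => hvt (h ▸ hu)), mul_zero]

theorem bary_nonneg (hx : x ∈ hull t) (hv : v ∈ s) : 0 ≤ bary s v x := by
  by_cases hvt : v ∈ t
  · obtain ⟨w, hw0, hw, rfl⟩ := mem_hull_iff.1 hx
    rw [bary_sum_smul hs hts hw hvt]
    exact hw0 v hvt
  · rw [bary_eq_zero hs hts hx hv hvt]

theorem sum_bary (hx : x ∈ hull t) : ∑ v ∈ t, bary s v x = 1 := by
  obtain ⟨w, -, hw, rfl⟩ := mem_hull_iff.1 hx
  rw [← hw]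
  exact Finset.sum_congr rfl fun v hv => by rw [bary_sum_smul hs hts hw hv]

theorem sum_bary_smul (hx : x ∈ hull t) : ∑ v ∈ t, bary s v x • v = x := by
  obtain ⟨w, -, hw, rfl⟩ := mem_hull_iff.1 hx
  exact Finset.sum_congr rfl fun v hv => by rw [bary_sum_smul hs hts hw hv]

theorem bary_le_one (hx : x ∈ hull t) (hv : v ∈ s) : bary s v x ≤ 1 := by
  by_cases hvt : v ∈ t
  · rw [← sum_bary hs hts hx]
    exact Finset.single_le_sum (f := fun v => bary s v x)
      (fun u hu => bary_nonneg hs hts hx (hts hu)) hvt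
  · rw [bary_eq_zero hs hts hx hv hvt]
    exact zero_le_one

/-- On a common face the coordinates depend on the face alone. This is what makes finite element
functions match across neighbouring cells. -/
theorem bary_eq_bary {s' : Finset (EuclideanSpace ℝ (Fin n))} (hs' : IsCell s') (hts' : t ⊆ s')
    (hx : x ∈ hull t) (hv : v ∈ t) : bary s v x = bary s' v x := by
  obtain ⟨w, -, hw, rfl⟩ := mem_hull_iff.1 hx
  rw [bary_sum_smul hs hts hw hv, bary_sum_smul hs' hts' hw hv]

end Cell

/-- The coordinate takes values in the unit interval at both ends of the diameter of the ball in the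
direction `u`, so over the length `2 * ρ` it changes by at most one. -/
theorem abs_bary_linear_le {s : Finset (EuclideanSpace ℝ (Fin n))} (hs : IsCell s)
    {v c : EuclideanSpace ℝ (Fin n)} (hv : v ∈ s) {ρ : ℝ} (hρ : 0 < ρ)
    (hball : Metric.closedBall c ρ ⊆ hull s) (u : EuclideanSpace ℝ (Fin n)) :
    |(bary s v).linear u| ≤ ‖u‖ / (2 * ρ) := by
  rcases eq_or_ne u 0 with rfl | hu
  · simp
  have hu0 : 0 < ‖u‖ := norm_pos_iff.2 hu
  have key (a : ℝ) (ha : |a| = 1) : c + (a * (ρ / ‖u‖)) • u ∈ hull s := by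
    apply hball
    rw [Metric.mem_closedBall, dist_eq_norm, add_sub_cancel_left, norm_smul, Real.norm_eq_abs,
      abs_mul, ha, one_mul, abs_of_pos (by positivity), div_mul_cancel₀ _ hu0.ne']
  have hval (a : ℝ) : bary s v (c + a • u) = a * (bary s v).linear u + bary s v c := by
    have := (bary s v).map_vadd c (a • u)
    rw [vadd_eq_add, add_comm] at this
    rw [this]
    simp
  have h1 := key 1 (by simp)
  have h2 := key (-1) (by simp)
  have a1 := bary_nonneg hs subset_rfl h1 hv
  have a2 := bary_nonneg hs subset_rfl h2 hv
  have b1 := bary_le_one hs subset_rfl h1 hv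
  have b2 := bary_le_one hs subset_rfl h2 hv
  rw [hval] at a1 a2 b1 b2
  have h3 : |2 * ρ / ‖u‖ * (bary s v).linear u| ≤ 1 := by
    rw [abs_le]
    constructor
    · ring_nf at a1 a2 b1 b2 ⊢; linarith
    · ring_nf at a1 a2 b1 b2 ⊢; linarith
  rw [abs_mul, abs_of_pos (by positivity)] at h3
  rw [le_div_iff₀ (by positivity)]
  rw [div_mul_eq_mul_div, div_le_one hu0] at h3
  linarith

theorem abs_bary_linear_le_of_shapeRegular {s : Finset (EuclideanSpace ℝ (Fin n))} (hs : IsCell s)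
    {v c : EuclideanSpace ℝ (Fin n)} (hv : v ∈ s) {ρ σ : ℝ} (hρ : 0 < ρ)
    (hball : Metric.closedBall c ρ ⊆ hull s) (hsize : size s ≤ σ * (2 * ρ)) (hpos : 0 < size s)
    (u : EuclideanSpace ℝ (Fin n)) :
    |(bary s v).linear u| ≤ σ / size s * ‖u‖ := by
  refine (abs_bary_linear_le hs hv hρ hball u).trans ?_
  rw [div_eq_mul_inv, mul_comm]
  refine mul_le_mul_of_nonneg_right ?_ (norm_nonneg u)
  rw [inv_eq_one_div, div_le_div_iff₀ (by positivity) hpos]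
  linarith

theorem exists_mvPolynomial_of_affineMap (A : EuclideanSpace ℝ (Fin n) →ᵃ[ℝ] ℝ) :
    ∃ p : MvPolynomial (Fin n) ℝ, p.totalDegree ≤ 1 ∧
      ∀ x : EuclideanSpace ℝ (Fin n), MvPolynomial.eval (fun i => x i) p = A x := by
  refine ⟨MvPolynomial.C (A 0) + ∑ i : Fin n,
    MvPolynomial.C (A.linear (EuclideanSpace.single i 1)) * MvPolynomial.X i, ?_, fun x => ?_⟩
  · refine (MvPolynomial.totalDegree_add _ _).trans (max_le (by simp) ?_)
    refine (MvPolynomial.totalDegree_finsetSum _ _).trans (Finset.sup_le fun i _ => ?_)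
    refine (MvPolynomial.totalDegree_mul _ _).trans ?_
    simp
  · have h : A x = A.linear x + A 0 := by simpa using A.map_vadd 0 x
    have hx : x = ∑ i : Fin n, x i • EuclideanSpace.single i (1 : ℝ) := by
      ext j
      simp [Finset.sum_apply, Pi.single_apply]
    rw [h]
    conv_rhs => rw [hx, map_sum]
    simp [mul_comm, add_comm]

/-- A product of functions given by polynomials is given by a polynomial. -/
theorem exists_mvPolynomial_prod {κ : Type*} (u : Finset κ) (a : κ → ℕ)
    (f : κ → EuclideanSpace ℝ (Fin n) → ℝ)
    (h : ∀ k ∈ u, ∃ p : MvPolynomial (Fin n) ℝ, p.totalDegree ≤ a k ∧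
      ∀ x : EuclideanSpace ℝ (Fin n), MvPolynomial.eval (fun i => x i) p = f k x) :
    ∃ p : MvPolynomial (Fin n) ℝ, p.totalDegree ≤ ∑ k ∈ u, a k ∧
      ∀ x : EuclideanSpace ℝ (Fin n), MvPolynomial.eval (fun i => x i) p = ∏ k ∈ u, f k x := by
  choose! p hp hpe using h
  refine ⟨∏ k ∈ u, p k, (MvPolynomial.totalDegree_finsetProd _ _).trans (Finset.sum_le_sum hp),
    fun x => ?_⟩
  rw [map_prod]
  exact Finset.prod_congr rfl fun k hk => hpe k hk x

theorem exists_mvPolynomial_shape {s : Finset (EuclideanSpace ℝ (Fin n))} {r : ℕ}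
    {α : EuclideanSpace ℝ (Fin n) →₀ ℕ} (hα : α ∈ latticeIndices s r) :
    ∃ p : MvPolynomial (Fin n) ℝ, p.totalDegree ≤ r ∧
      ∀ x : EuclideanSpace ℝ (Fin n),
        MvPolynomial.eval (fun i => x i) p = shape r α fun v => bary s v x := by
  rw [mem_latticeIndices] at hα
  have hsum : ∑ v ∈ α.support, α v = r := by
    rw [← hα.1]
    exact Finset.sum_subset hα.2 fun v _ hv => Finsupp.notMem_support_iff.1 hv
  obtain ⟨p, hp, hpe⟩ := exists_mvPolynomial_prod α.support α
    (fun v x => ∏ j ∈ Finset.range (α v), ((r : ℝ) * bary s v x - j) / (j + 1)) fun v _ => by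
      obtain ⟨p, hp, hpe⟩ := exists_mvPolynomial_prod (Finset.range (α v)) (fun _ => 1)
        (fun j x => ((r : ℝ) * bary s v x - j) / (j + 1)) fun j _ => by
          obtain ⟨p, hp, hpe⟩ := exists_mvPolynomial_of_affineMap (bary s v)
          refine ⟨((r : ℝ) / (j + 1)) • p - MvPolynomial.C ((j : ℝ) / (j + 1)), ?_, fun x => ?_⟩
          · refine (MvPolynomial.totalDegree_sub _ _).trans (max_le ?_ (by simp))
            exact (MvPolynomial.totalDegree_smul_le _ _).trans hp
          · rw [map_sub, MvPolynomial.smul_eval, hpe, MvPolynomial.eval_C]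
            ring
      exact ⟨p, by simpa using hp, hpe⟩
  exact ⟨p, hsum ▸ hp, hpe⟩

end Barycentric
end NitscheHybrid
namespace NitscheHybrid

/-! ### Finite element functions from nodal values, and the conforming map -/

section NodalExtension

variable {n : ℕ}

/-- The lattice point with index `α`. -/
noncomputable def nodePoint (r : ℕ) (α : EuclideanSpace ℝ (Fin n) →₀ ℕ) :
    EuclideanSpace ℝ (Fin n) :=
  ∑ v ∈ α.support, nodeCoord r α v • v

theorem nodePoint_eq_sum {t : Finset (EuclideanSpace ℝ (Fin n))} {r : ℕ}
    {α : EuclideanSpace ℝ (Fin n) →₀ ℕ} (hα : α ∈ latticeIndices t r) :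
    nodePoint r α = ∑ v ∈ t, nodeCoord r α v • v := by
  refine Finset.sum_subset (mem_latticeIndices.1 hα).2 fun v _ hv => ?_
  simp [nodeCoord, Finsupp.notMem_support_iff.1 hv]

theorem nodePoint_mem_hull {t : Finset (EuclideanSpace ℝ (Fin n))} {r : ℕ} (hr : 1 ≤ r)
    {α : EuclideanSpace ℝ (Fin n) →₀ ℕ} (hα : α ∈ latticeIndices t r) :
    nodePoint r α ∈ hull t :=
  mem_hull_iff.2 ⟨nodeCoord r α, fun _ _ => by unfold nodeCoord; positivity,
    sum_nodeCoord hr hα, (nodePoint_eq_sum hα).symm⟩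

theorem eval_eq_sum_nodePoint {s t : Finset (EuclideanSpace ℝ (Fin n))} (hs : IsCell s)
    (hts : t ⊆ s) {r : ℕ} (hr : 1 ≤ r) {p : MvPolynomial (Fin n) ℝ} (hp : p.totalDegree ≤ r)
    {x : EuclideanSpace ℝ (Fin n)} (hx : x ∈ hull t) :
    MvPolynomial.eval (fun i => x i) p = ∑ α ∈ latticeIndices t r,
      MvPolynomial.eval (fun i => nodePoint r α i) p * shape r α fun v => bary s v x := by
  have h := eval_eq_sum_shape t hr (fun v i => v i) hp (sum_bary hs hts hx)
  have hcoord (w : EuclideanSpace ℝ (Fin n) → ℝ) (i : Fin n) :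
      ∑ v ∈ t, w v * v i = (∑ v ∈ t, w v • v) i := by simp
  simp only [hcoord, sum_bary_smul hs hts hx] at h
  rw [h]
  exact Finset.sum_congr rfl fun α hα => by rw [nodePoint_eq_sum hα]

/-- The polynomial on a simplex with prescribed nodal values. -/
noncomputable def cellExt (r : ℕ) (s : Finset (EuclideanSpace ℝ (Fin n)))
    (c : (EuclideanSpace ℝ (Fin n) →₀ ℕ) → ℝ) (x : EuclideanSpace ℝ (Fin n)) : ℝ :=
  ∑ α ∈ latticeIndices s r, c α * shape r α fun v => bary s v x

/-- A shape function whose index charges a vertex outside `t` contains that vertex's coordinate as a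
factor, which is zero on the face. Values on a face therefore depend only on the nodes of that face.
-/
theorem cellExt_eq_sum_of_mem_hull {s t : Finset (EuclideanSpace ℝ (Fin n))} (hs : IsCell s)
    (hts : t ⊆ s) (r : ℕ) (c : (EuclideanSpace ℝ (Fin n) →₀ ℕ) → ℝ)
    {x : EuclideanSpace ℝ (Fin n)} (hx : x ∈ hull t) :
    cellExt r s c x = ∑ α ∈ latticeIndices t r, c α * shape r α fun v => bary s v x := by
  refine (Finset.sum_subset (latticeIndices_mono hts r) fun α hα hαt => ?_).symm
  obtain ⟨v, hv, hvt⟩ : ∃ v ∈ α.support, v ∉ t := by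
    by_contra! h
    exact hαt (mem_latticeIndices_of_support_subset hα hts h)
  rw [shape_eq_zero (v := v) (j := 0), mul_zero]
  · exact Nat.pos_of_ne_zero (Finsupp.mem_support_iff.1 hv)
  · rw [bary_eq_zero hs hts hx ((mem_latticeIndices.1 hα).2 hv) hvt]
    simp

theorem shape_congr {ι : Type*} {r : ℕ} {α : ι →₀ ℕ} {l l' : ι → ℝ}
    (h : ∀ v ∈ α.support, l v = l' v) : shape r α l = shape r α l' :=
  Finset.prod_congr rfl fun v hv => by rw [h v hv]

theorem exists_mvPolynomial_cellExt (r : ℕ) (s : Finset (EuclideanSpace ℝ (Fin n)))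
    (c : (EuclideanSpace ℝ (Fin n) →₀ ℕ) → ℝ) :
    ∃ p : MvPolynomial (Fin n) ℝ, p.totalDegree ≤ r ∧
      ∀ x : EuclideanSpace ℝ (Fin n), MvPolynomial.eval (fun i => x i) p = cellExt r s c x := by
  choose! p hp hpe using fun α (hα : α ∈ latticeIndices s r) => exists_mvPolynomial_shape hα
  refine ⟨∑ α ∈ latticeIndices s r, c α • p α, ?_, fun x => ?_⟩
  · refine (MvPolynomial.totalDegree_finsetSum _ _).trans (Finset.sup_le fun α hα => ?_)
    exact (MvPolynomial.totalDegree_smul_le _ _).trans (hp α hα)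
  · rw [map_sum, cellExt]
    exact Finset.sum_congr rfl fun α hα => by rw [MvPolynomial.smul_eval, hpe α hα]

theorem continuous_eval (p : MvPolynomial (Fin n) ℝ) :
    Continuous fun x : EuclideanSpace ℝ (Fin n) => MvPolynomial.eval (fun i => x i) p :=
  p.continuous_eval.comp (by fun_prop)

open Classical in
/-- The finite element function on `T` with prescribed values at the lattice points. -/
noncomputable def nodalExt (T : Triangulation n) (r : ℕ)
    (c : (EuclideanSpace ℝ (Fin n) →₀ ℕ) → ℝ) (x : EuclideanSpace ℝ (Fin n)) : ℝ :=
  if h : ∃ s ∈ T.cells, x ∈ hull s then cellExt r h.choose c x else 0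

/-- Independence of the chosen cell: by conformity two cells containing `x` share a face through
`x`, and both expansions reduce to the same sum over the nodes of that face. -/
theorem nodalExt_eq_cellExt (T : Triangulation n) (r : ℕ)
    (c : (EuclideanSpace ℝ (Fin n) →₀ ℕ) → ℝ) {s : Finset (EuclideanSpace ℝ (Fin n))}
    (hs : s ∈ T.cells) {x : EuclideanSpace ℝ (Fin n)} (hx : x ∈ hull s) :
    nodalExt T r c x = cellExt r s c x := by
  classical
  have h : ∃ s ∈ T.cells, x ∈ hull s := ⟨s, hs, hx⟩
  rw [nodalExt, dif_pos h]
  obtain ⟨ht, hxt⟩ := h.choose_spec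
  generalize h.choose = t at ht hxt
  have hxst : x ∈ hull (s ∩ t) := T.hull_inter hs ht ▸ ⟨hx, hxt⟩
  rw [cellExt_eq_sum_of_mem_hull (T.isCell hs) Finset.inter_subset_left r c hxst,
    cellExt_eq_sum_of_mem_hull (T.isCell ht) Finset.inter_subset_right r c hxst]
  refine Finset.sum_congr rfl fun α hα => ?_
  rw [shape_congr fun v hv => (bary_eq_bary (T.isCell ht) Finset.inter_subset_right
    (T.isCell hs) Finset.inter_subset_left hxst ((mem_latticeIndices.1 hα).2 hv))]

theorem nodalExt_mem_lagrange (T : Triangulation n) (r : ℕ)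
    (c : (EuclideanSpace ℝ (Fin n) →₀ ℕ) → ℝ) : nodalExt T r c ∈ T.lagrange r := by
  choose p hp hpe using fun s => exists_mvPolynomial_cellExt (n := n) r s c
  have heq : ∀ s ∈ T.cells, ∀ x ∈ hull s,
      nodalExt T r c x = MvPolynomial.eval (fun i => x i) (p s) := fun s hs x hx => by
    rw [nodalExt_eq_cellExt T r c hs hx, hpe]
  refine ⟨?_, fun s hs => ⟨p s, hp s, heq s hs⟩, fun x hx => ?_⟩
  · have hU : T.support = ⋃ s : T.cells, hull s.1 := by
      ext x; simp [Triangulation.support]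
    rw [hU]
    refine (locallyFinite_of_finite _).continuousOn_iUnion (fun s => isClosed_hull s.1) fun s => ?_
    exact (continuous_eval (p s.1)).continuousOn.congr (heq s.1 s.2)
  · rw [nodalExt, dif_neg]
    rintro ⟨s, hs, hxs⟩
    exact hx (hull_subset_support T hs hxs)

/-- Interpolation on a face is exact for polynomials of degree at most `r`. Applied to the jump, it
shows that the correction reproduces the jump on the whole face and not only at its nodes. -/
theorem nodalExt_eq_of_mem_face (T : Triangulation n) {r : ℕ} (hr : 1 ≤ r)
    {c : (EuclideanSpace ℝ (Fin n) →₀ ℕ) → ℝ} {s e : Finset (EuclideanSpace ℝ (Fin n))}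
    (hs : s ∈ T.cells) (hes : e ⊆ s) {p : MvPolynomial (Fin n) ℝ} (hp : p.totalDegree ≤ r)
    (hc : ∀ α ∈ latticeIndices e r, c α = MvPolynomial.eval (fun i => nodePoint r α i) p)
    {x : EuclideanSpace ℝ (Fin n)} (hx : x ∈ hull e) :
    nodalExt T r c x = MvPolynomial.eval (fun i => x i) p := by
  rw [nodalExt_eq_cellExt T r c hs (hull_mono hes hx),
    cellExt_eq_sum_of_mem_hull (T.isCell hs) hes r c hx,
    eval_eq_sum_nodePoint (T.isCell hs) hes hr hp hx]
  exact Finset.sum_congr rfl fun α hα => by rw [hc α hα]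

/-- `nodalExt` as a linear map of the nodal values. -/
noncomputable def nodalExtₗ (T : Triangulation n) (r : ℕ) :
    ((EuclideanSpace ℝ (Fin n) →₀ ℕ) → ℝ) →ₗ[ℝ] T.lagrange r where
  toFun c := ⟨nodalExt T r c, nodalExt_mem_lagrange T r c⟩
  map_add' c d := by
    ext x
    by_cases h : ∃ s ∈ T.cells, x ∈ hull s
    · obtain ⟨s, hs, hx⟩ := h
      simp [nodalExt_eq_cellExt T r _ hs hx, cellExt, add_mul, Finset.sum_add_distrib]
    · simp [nodalExt, dif_neg h]
  map_smul' a c := by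
    ext x
    by_cases h : ∃ s ∈ T.cells, x ∈ hull s
    · obtain ⟨s, hs, hx⟩ := h
      simp [nodalExt_eq_cellExt T r _ hs hx, cellExt, mul_assoc, Finset.mul_sum]
    · simp [nodalExt, dif_neg h]

open Classical in
/-- The values of the jump `v₁ - v₂` at the lattice points in `A`, and zero at the others. -/
noncomputable def jumpValues (A : Set (EuclideanSpace ℝ (Fin n))) (Th TH : Triangulation n)
    (r : ℕ) : (Th.lagrange r × TH.lagrange r) →ₗ[ℝ]
      ((EuclideanSpace ℝ (Fin n) →₀ ℕ) → ℝ) where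
  toFun v α := if nodePoint r α ∈ A then
    (v.1 : EuclideanSpace ℝ (Fin n) → ℝ) (nodePoint r α) -
      (v.2 : EuclideanSpace ℝ (Fin n) → ℝ) (nodePoint r α) else 0
  map_add' v w := by
    ext α
    by_cases h : nodePoint r α ∈ A <;> simp [h]
    ring
  map_smul' a v := by
    ext α
    by_cases h : nodePoint r α ∈ A <;> simp [h]
    ring

/-- The averaging operator: subtract from the fine component the extension of the jump at the
lattice points in `A`. -/
noncomputable def conformingMap (A : Set (EuclideanSpace ℝ (Fin n))) (Th TH : Triangulation n)
    (r : ℕ) : (Th.lagrange r × TH.lagrange r) →ₗ[ℝ] (Th.lagrange r × TH.lagrange r) :=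
  (LinearMap.fst ℝ _ _ - (nodalExtₗ Th r).comp (jumpValues A Th TH r)).prod (LinearMap.snd ℝ _ _)

theorem conformingMap_fst_apply (A : Set (EuclideanSpace ℝ (Fin n))) (Th TH : Triangulation n)
    (r : ℕ) (v : Th.lagrange r × TH.lagrange r) (x : EuclideanSpace ℝ (Fin n)) :
    ((conformingMap A Th TH r v).1 : EuclideanSpace ℝ (Fin n) → ℝ) x =
      (v.1 : EuclideanSpace ℝ (Fin n) → ℝ) x - nodalExt Th r (jumpValues A Th TH r v) x :=
  rfl

theorem conformingMap_snd (A : Set (EuclideanSpace ℝ (Fin n))) (Th TH : Triangulation n)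
    (r : ℕ) (v : Th.lagrange r × TH.lagrange r) :
    (conformingMap A Th TH r v).2 = v.2 :=
  rfl

/-- On a face of a fine simplex that lies in a coarse simplex, the jump is a polynomial. -/
theorem exists_mvPolynomial_jump {Th TH : Triangulation n} {r : ℕ}
    (v : Th.lagrange r × TH.lagrange r) {s S : Finset (EuclideanSpace ℝ (Fin n))}
    (hs : s ∈ Th.cells) (hS : S ∈ TH.cells) {e : Set (EuclideanSpace ℝ (Fin n))}
    (hes : e ⊆ hull s) (heS : e ⊆ hull S) :
    ∃ p : MvPolynomial (Fin n) ℝ, p.totalDegree ≤ r ∧ ∀ x ∈ e,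
      (v.1 : EuclideanSpace ℝ (Fin n) → ℝ) x - (v.2 : EuclideanSpace ℝ (Fin n) → ℝ) x =
        MvPolynomial.eval (fun i => x i) p := by
  obtain ⟨p, hp, hpe⟩ := v.1.2.2.1 s hs
  obtain ⟨q, hq, hqe⟩ := v.2.2.2.1 S hS
  exact ⟨p - q, (MvPolynomial.totalDegree_sub _ _).trans (max_le hp hq), fun x hx => by
    rw [hpe x (hes hx), hqe x (heS hx), map_sub]⟩

theorem conformingMap_fst_eq {Th TH : Triangulation n} {r : ℕ} (hr : 1 ≤ r)
    {A : Set (EuclideanSpace ℝ (Fin n))} (v : Th.lagrange r × TH.lagrange r)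
    {s S e : Finset (EuclideanSpace ℝ (Fin n))} (hs : s ∈ Th.cells) (hS : S ∈ TH.cells)
    (hes : e ⊆ s) (heS : hull e ⊆ hull S) (heA : hull e ⊆ A)
    {x : EuclideanSpace ℝ (Fin n)} (hx : x ∈ hull e) :
    ((conformingMap A Th TH r v).1 : EuclideanSpace ℝ (Fin n) → ℝ) x =
      (v.2 : EuclideanSpace ℝ (Fin n) → ℝ) x := by
  obtain ⟨p, hp, hpe⟩ := exists_mvPolynomial_jump v hs hS (hull_mono hes) heS
  rw [conformingMap_fst_apply, nodalExt_eq_of_mem_face Th hr hs hes hp (fun α hα => ?_) hx,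
    ← hpe x hx, sub_sub_cancel]
  have hα' := nodePoint_mem_hull hr hα
  rw [← hpe _ hα']
  exact if_pos (heA hα')

end NodalExtension
end NitscheHybrid
namespace NitscheHybrid

/-! ### Nodal values on a face bounded by the $L^2$ norm on the face -/

section FaceBound

open MeasureTheory

/-- Compactness of the unit sphere: a continuous positive function has a positive minimum there, and
homogeneity spreads the bound to all of `V`. The sphere is empty exactly when `V` is trivial, which
is treated apart. -/
theorem exists_norm_sq_le_of_homogeneous {V : Type*} [NormedAddCommGroup V] [NormedSpace ℝ V]
    [FiniteDimensional ℝ V] {F : V → ℝ} (hF : Continuous F)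
    (hsmul : ∀ (a : ℝ) c, F (a • c) = a ^ 2 * F c) (hpos : ∀ c, c ≠ 0 → 0 < F c) :
    ∃ C : ℝ, 0 < C ∧ ∀ c, ‖c‖ ^ 2 ≤ C * F c := by
  have : ProperSpace V := FiniteDimensional.proper ℝ V
  have h0 : F 0 = 0 := by simpa using hsmul 0 0
  rcases (Metric.sphere (0 : V) 1).eq_empty_or_nonempty with h | h
  · refine ⟨1, one_pos, fun c => ?_⟩
    have hc : c = 0 := by
      by_contra hc
      have : ‖c‖⁻¹ • c ∈ Metric.sphere (0 : V) 1 := by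
        simp [norm_smul, norm_ne_zero_iff.2 hc]
      rw [h] at this
      exact this
    simp [hc, h0]
  · obtain ⟨x, hx, hmin⟩ := (isCompact_sphere (0 : V) 1).exists_isMinOn h hF.continuousOn
    have hx0 : 0 < F x := hpos x (by rintro rfl; simp at hx)
    refine ⟨(F x)⁻¹, inv_pos.2 hx0, fun c => ?_⟩
    rcases eq_or_ne c 0 with rfl | hc
    · simp [h0]
    have hc0 : 0 < ‖c‖ := norm_pos_iff.2 hc
    have h1 : F x ≤ F (‖c‖⁻¹ • c) := hmin (by simp [norm_smul, hc0.ne'])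
    rw [hsmul] at h1
    rw [inv_mul_eq_div, le_div_iff₀ hx0]
    calc ‖c‖ ^ 2 * F x ≤ ‖c‖ ^ 2 * (‖c‖⁻¹ ^ 2 * F c) := by gcongr
      _ = F c := by field_simp

/-- The reference simplex in `ℝᵈ`. -/
def refSimplex (d : ℕ) : Set (EuclideanSpace ℝ (Fin d)) :=
  {y | (∀ i, 0 ≤ y i) ∧ ∑ i, y i ≤ 1}

/-- The barycentric coordinates of the reference simplex. -/
noncomputable def refCoord {d : ℕ} (y : EuclideanSpace ℝ (Fin d)) : Fin (d + 1) → ℝ :=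
  Fin.cons (1 - ∑ i, y i) fun i => y i

theorem sum_refCoord {d : ℕ} (y : EuclideanSpace ℝ (Fin d)) : ∑ j, refCoord y j = 1 := by
  simp [refCoord, Fin.sum_univ_succ]

theorem refCoord_nonneg {d : ℕ} {y : EuclideanSpace ℝ (Fin d)} (hy : y ∈ refSimplex d)
    (j : Fin (d + 1)) : 0 ≤ refCoord y j := by
  refine Fin.cases ?_ (fun i => ?_) j
  · simpa [refCoord] using hy.2
  · simpa [refCoord] using hy.1 i

theorem continuous_refCoord (d : ℕ) :
    Continuous (refCoord : EuclideanSpace ℝ (Fin d) → Fin (d + 1) → ℝ) := by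
  refine continuous_pi fun j => Fin.cases ?_ (fun i => ?_) j
  · simp only [refCoord, Fin.cons_zero]; fun_prop
  · simp only [refCoord, Fin.cons_succ]; fun_prop

theorem continuous_shape {ι : Type*} (r : ℕ) (α : ι →₀ ℕ) :
    Continuous (shape r α : (ι → ℝ) → ℝ) := by
  unfold shape; fun_prop

theorem isClosed_refSimplex (d : ℕ) : IsClosed (refSimplex d) := by
  have h : refSimplex d = (⋂ i : Fin d, {y | 0 ≤ y i}) ∩ {y | ∑ i, y i ≤ 1} := by
    ext y; simp [refSimplex]
  rw [h]
  exact (isClosed_iInter fun i => isClosed_le continuous_const (by fun_prop)).inter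
    (isClosed_le (by fun_prop) continuous_const)

theorem isCompact_refSimplex (d : ℕ) : IsCompact (refSimplex d) := by
  refine Metric.isCompact_of_isClosed_isBounded (isClosed_refSimplex d) ?_
  refine (Metric.isBounded_closedBall (x := (0 : EuclideanSpace ℝ (Fin d)))
    (r := Real.sqrt d)).subset fun y hy => ?_
  rw [mem_closedBall_zero_iff, EuclideanSpace.norm_eq]
  refine Real.sqrt_le_sqrt ?_
  calc ∑ i, ‖y i‖ ^ 2 ≤ ∑ _i : Fin d, (1 : ℝ) := by
        refine Finset.sum_le_sum fun i _ => ?_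
        have h0 := hy.1 i
        have h1 : y i ≤ 1 :=
          (Finset.single_le_sum (f := fun i => y i) (fun i _ => hy.1 i) (Finset.mem_univ i)).trans
            hy.2
        rw [Real.norm_eq_abs, sq_abs]
        nlinarith
    _ = d := by simp

theorem convex_refSimplex (d : ℕ) : Convex ℝ (refSimplex d) := by
  intro x hx y hy a b ha hb hab
  refine ⟨fun i => ?_, ?_⟩
  · have := hx.1 i
    have := hy.1 i
    simp only [PiLp.add_apply, PiLp.smul_apply, smul_eq_mul]
    positivity
  · simp only [PiLp.add_apply, PiLp.smul_apply, smul_eq_mul, Finset.sum_add_distrib,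
      ← Finset.mul_sum]
    calc _ ≤ a * 1 + b * 1 := by gcongr; exacts [hx.2, hy.2]
      _ = 1 := by linarith

/-- Needed to pass from vanishing almost everywhere to vanishing everywhere, including at lattice
nodes on the boundary. -/
theorem refSimplex_subset_closure_interior (d : ℕ) :
    refSimplex d ⊆ closure (interior (refSimplex d)) := by
  have hne : (interior (refSimplex d)).Nonempty := by
    have hopen : IsOpen {y : EuclideanSpace ℝ (Fin d) | (∀ i, 0 < y i) ∧ ∑ i, y i < 1} := by
      have h : {y : EuclideanSpace ℝ (Fin d) | (∀ i, 0 < y i) ∧ ∑ i, y i < 1} =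
          (⋂ i : Fin d, {y | 0 < y i}) ∩ {y | ∑ i, y i < 1} := by
        ext y; simp
      rw [h]
      exact (isOpen_iInter_of_finite fun i => isOpen_lt continuous_const (by fun_prop)).inter
        (isOpen_lt (by fun_prop) continuous_const)
    refine ⟨WithLp.toLp 2 fun _ => (1 : ℝ) / (d + 1), mem_interior.2 ⟨_, ?_, hopen, ?_, ?_⟩⟩
    · exact fun y hy => ⟨fun i => (hy.1 i).le, hy.2.le⟩
    · intro i
      change (0 : ℝ) < 1 / (d + 1)
      positivity
    · simp only [Finset.sum_const, Finset.card_univ, Fintype.card_fin, nsmul_eq_mul]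
      rw [mul_one_div, div_lt_one (by positivity)]
      linarith
  rw [(convex_refSimplex d).closure_interior_eq_closure_of_nonempty_interior hne]
  exact subset_closure

theorem exists_refCoord_eq {d : ℕ} {l : Fin (d + 1) → ℝ} (h0 : ∀ j, 0 ≤ l j)
    (h1 : ∑ j, l j = 1) : ∃ y ∈ refSimplex d, refCoord y = l := by
  rw [Fin.sum_univ_succ] at h1
  refine ⟨WithLp.toLp 2 fun i => l i.succ, ⟨fun i => h0 _, ?_⟩, ?_⟩
  · have := h0 0
    change ∑ i : Fin d, l i.succ ≤ 1
    linarith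
  · ext j
    refine Fin.cases ?_ (fun i => ?_) j
    · simp only [refCoord, Fin.cons_zero]
      linarith
    · simp [refCoord]

/-- The nodal values of a polynomial on the reference simplex are controlled by its `L²` norm. -/
theorem exists_sq_le_integral_refSimplex (d : ℕ) {r : ℕ} (hr : 1 ≤ r) :
    ∃ C : ℝ, 0 < C ∧ ∀ c : (Fin (d + 1) →₀ ℕ) → ℝ,
      ∀ β ∈ latticeIndices (Finset.univ : Finset (Fin (d + 1))) r,
        c β ^ 2 ≤ C * ∫ y in refSimplex d,
          (∑ α ∈ latticeIndices (Finset.univ : Finset (Fin (d + 1))) r,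
            c α * shape r α (refCoord y)) ^ 2 := by
  set I := latticeIndices (Finset.univ : Finset (Fin (d + 1))) r with hI
  let G : (I → ℝ) → EuclideanSpace ℝ (Fin d) → ℝ :=
    fun c y => ∑ α : I, c α * shape r α.1 (refCoord y)
  have hG : Continuous fun q : (I → ℝ) × EuclideanSpace ℝ (Fin d) => G q.1 q.2 := by
    refine continuous_finsetSum _ fun α _ => ?_
    refine Continuous.mul (by fun_prop) ?_
    exact (continuous_shape r α.1).comp ((continuous_refCoord d).comp continuous_snd)
  let F : (I → ℝ) → ℝ := fun c => ∫ y in refSimplex d, G c y ^ 2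
  have hF : Continuous F := continuous_parametric_integral_of_continuous
    (f := fun c y => G c y ^ 2) (by exact hG.pow 2) (isCompact_refSimplex d)
  have hsmul : ∀ (a : ℝ) c, F (a • c) = a ^ 2 * F c := by
    intro a c
    simp only [F]
    rw [← integral_const_mul]
    congr 1 with y
    simp only [G, Pi.smul_apply, smul_eq_mul, mul_assoc]
    rw [← Finset.mul_sum, mul_pow]
  have hpos : ∀ c, c ≠ 0 → 0 < F c := by
    intro c hc
    have hGc : Continuous (G c) := hG.comp (by fun_prop : Continuous fun y => (c, y))
    have hnn : 0 ≤ F c := integral_nonneg fun y => sq_nonneg _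
    -- If the integral is zero, the continuous integrand vanishes on the whole simplex, and its
    -- values at the nodes are the coefficients.
    refine lt_of_le_of_ne hnn fun hzero => hc ?_
    have hint : IntegrableOn (fun y => G c y ^ 2) (refSimplex d) :=
      (hGc.pow 2).continuousOn.integrableOn_compact (isCompact_refSimplex d)
    have hae := (integral_eq_zero_iff_of_nonneg (fun y => sq_nonneg (G c y)) hint).1 hzero.symm
    have heq := Measure.eqOn_of_ae_eq hae (hGc.pow 2).continuousOn continuousOn_const
      (refSimplex_subset_closure_interior d)
    ext β
    obtain ⟨y, hy, hyl⟩ := exists_refCoord_eq (d := d) (l := nodeCoord r β.1)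
      (fun j => by unfold nodeCoord; positivity) (sum_nodeCoord hr β.2)
    have h1 : G c y = 0 := by simpa using heq hy
    simp only [G, hyl] at h1
    rw [Finset.sum_eq_single β] at h1
    · simpa [shape_nodeCoord_self hr] using h1
    · intro α _ hne
      rw [shape_nodeCoord_of_ne hr α.2 β.2 fun h => hne (Subtype.ext h), mul_zero]
    · simp
  obtain ⟨C, hC, hCF⟩ := exists_norm_sq_le_of_homogeneous hF hsmul hpos
  refine ⟨C, hC, fun c β hβ => ?_⟩
  have h1 := hCF fun α => c α.1
  have h2 : |c β| ≤ ‖fun α : I => c α.1‖ := norm_le_pi_norm (fun α : I => c α.1) ⟨β, hβ⟩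
  have h3 : F (fun α => c α.1) = ∫ y in refSimplex d,
      (∑ α ∈ I, c α * shape r α (refCoord y)) ^ 2 := by
    simp only [F, G]
    congr 1 with y
    rw [← Finset.sum_coe_sort I]
  rw [← h3, ← sq_abs]
  exact (pow_le_pow_left₀ (abs_nonneg _) h2 2).trans h1

theorem euclideanHausdorffMeasure_image_le {X Y : Type*} [EMetricSpace X] [MeasurableSpace X]
    [BorelSpace X] [EMetricSpace Y] [MeasurableSpace Y] [BorelSpace Y] {f : X → Y} {K : NNReal}
    (hf : LipschitzWith K f) (d : ℕ) (A : Set X) :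
    μHE[d] (f '' A) ≤ (K : ENNReal) ^ d * μHE[d] A := by
  have h := hf.hausdorffMeasure_image_le (d := d) (by positivity) A
  rw [ENNReal.rpow_natCast] at h
  simp only [Measure.euclideanHausdorffMeasure_def, Measure.smul_apply, ENNReal.smul_def,
    smul_eq_mul]
  calc _ ≤ _ * ((K : ENNReal) ^ d * μH[d] A) := by gcongr
    _ = _ := by ring

/-- Change of variables inequality for a Lipschitz parametrization. -/
theorem integral_le_of_lipschitz {X : Type*} [MetricSpace X] [MeasurableSpace X]
    [BorelSpace X] {d : ℕ} {f : X → EuclideanSpace ℝ (Fin d)} {K : NNReal}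
    (hf : LipschitzWith K f) {A : Set X} (hA : IsCompact A) (hfin : μHE[d] A < ⊤)
    {B : Set (EuclideanSpace ℝ (Fin d))} (hB : B ⊆ f '' A)
    {g : EuclideanSpace ℝ (Fin d) → ℝ} (hg : Continuous g) (hg0 : ∀ y, 0 ≤ g y) :
    ∫ y in B, g y ≤ (K : ℝ) ^ d * ∫ x in A, g (f x) ∂μHE[d] := by
  -- The map expands $d$-dimensional measure by at most `K ^ d`, so `K ^ d` times the push-forward
  -- from `A` dominates Lebesgue measure on `B`. Injectivity is not needed.
  have hle : volume.restrict B ≤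
      ((K : ENNReal) ^ d) • (Measure.map f ((μHE[d] : Measure X).restrict A)) := by
    refine Measure.le_iff.2 fun W hW => ?_
    rw [Measure.restrict_apply hW, Measure.smul_apply, smul_eq_mul,
      Measure.map_apply hf.continuous.measurable hW,
      Measure.restrict_apply (hf.continuous.measurable hW),
      ← EuclideanSpace.euclideanHausdorffMeasure_eq_volume]
    refine le_trans (measure_mono ?_) (euclideanHausdorffMeasure_image_le hf d _)
    rintro y ⟨hyW, hyB⟩
    obtain ⟨x, hx, rfl⟩ := hB hyB
    exact ⟨x, ⟨hyW, hx⟩, rfl⟩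
  have : IsFiniteMeasure ((μHE[d] : Measure X).restrict A) :=
    ⟨by rwa [Measure.restrict_apply_univ]⟩
  have hint : Integrable g (Measure.map f ((μHE[d] : Measure X).restrict A)) := by
    rw [integrable_map_measure hg.aestronglyMeasurable hf.continuous.aemeasurable]
    obtain ⟨M, hM⟩ := hA.exists_bound_of_continuousOn (hg.comp hf.continuous).continuousOn
    exact Integrable.of_bound (hg.comp hf.continuous).aestronglyMeasurable M
      ((ae_restrict_iff' hA.measurableSet).2 (Filter.Eventually.of_forall hM))
  refine (integral_mono_measure hle (Filter.Eventually.of_forall hg0)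
    (hint.smul_measure (by finiteness))).trans_eq ?_
  rw [integral_smul_measure, integral_map hf.continuous.aemeasurable hg.aestronglyMeasurable]
  simp

variable {n : ℕ}

/-- A polynomial of degree `r` on a face is bounded by its `L²` norm on the face, with the scaling
given by a bound `K` for the gradients of the barycentric coordinates. -/
theorem exists_sq_eval_le_integral_face (d : ℕ) {r : ℕ} (hr : 1 ≤ r) :
    ∃ C : ℝ, 0 < C ∧ ∀ {s e : Finset (EuclideanSpace ℝ (Fin n))}, IsCell s → e ⊆ s →
      e.card = d + 1 → ∀ {K : ℝ}, 0 ≤ K →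
      (∀ v ∈ e, ∀ u : EuclideanSpace ℝ (Fin n), |(bary s v).linear u| ≤ K * ‖u‖) →
      ∀ {p : MvPolynomial (Fin n) ℝ}, p.totalDegree ≤ r → ∀ x ∈ hull e,
        (MvPolynomial.eval (fun i => x i) p) ^ 2 ≤
          C * K ^ d * ∫ x in hull e, (MvPolynomial.eval (fun i => x i) p) ^ 2 ∂μHE[d] := by
  classical
  obtain ⟨C, hC, hCI⟩ := exists_sq_le_integral_refSimplex d hr
  set I := latticeIndices (Finset.univ : Finset (Fin (d + 1))) r with hI
  obtain ⟨N, hN⟩ : ∃ N : ℝ, N = I.card := ⟨_, rfl⟩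
  have hN0 : 0 ≤ N := hN ▸ Nat.cast_nonneg _
  -- The factors bound, in turn, the sum of squared coefficients, the sum of squared shape
  -- functions, and the dimensional part of the Lipschitz constant of the chart. The added ones keep
  -- the constant positive.
  refine ⟨(N * C + 1) * (N * ((r : ℝ) ^ r) ^ 2 + 1) * (d + 1) ^ d, by positivity,
    ?_⟩
  intro s e hs hes hcard K hK hlin p hp x hx
  let u : Fin (d + 1) ≃ e := (Finset.equivFinOfCardEq hcard).symm
  have hsum {M : Type} [AddCommMonoid M] (w : EuclideanSpace ℝ (Fin n) → M) :
      ∑ v ∈ e, w v = ∑ j, w (u j).1 := by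
    rw [← Finset.sum_coe_sort e]
    exact (Equiv.sum_comp u fun v : e => w v.1).symm
  -- The chart `T` reads off all barycentric coordinates of the face but the first and is inverse to
  -- `P` between the face and the reference simplex. Only its Lipschitz constant enters the
  -- estimate; `d + 1` is a crude substitute for the square root of `d`.
  let T : EuclideanSpace ℝ (Fin n) → EuclideanSpace ℝ (Fin d) :=
    fun x => WithLp.toLp 2 fun i => bary s (u i.succ).1 x
  let P : EuclideanSpace ℝ (Fin d) → EuclideanSpace ℝ (Fin n) :=
    fun y => ∑ j, refCoord y j • (u j).1
  have hT : LipschitzWith (Real.toNNReal ((d + 1) * K)) T := by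
    refine LipschitzWith.of_dist_le_mul fun x y => ?_
    rw [Real.coe_toNNReal _ (by positivity), EuclideanSpace.dist_eq]
    refine Real.sqrt_le_iff.2 ⟨by positivity, ?_⟩
    calc ∑ i, dist (T x i) (T y i) ^ 2 ≤ ∑ _i : Fin d, (K * dist x y) ^ 2 := by
          refine Finset.sum_le_sum fun i _ => ?_
          refine pow_le_pow_left₀ dist_nonneg ?_ 2
          have : T x i - T y i = (bary s (u i.succ).1).linear (x - y) := by
            simp only [T]
            rw [← vsub_eq_sub x y, AffineMap.linearMap_vsub]; rfl
          rw [Real.dist_eq, this, dist_eq_norm]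
          exact hlin _ (u i.succ).2 _
      _ = d * (K * dist x y) ^ 2 := by simp
      _ ≤ (d + 1) ^ 2 * (K * dist x y) ^ 2 := by
          gcongr
          have : (0 : ℝ) ≤ d := by positivity
          nlinarith
      _ = _ := by ring
  have hTP : ∀ y, T (P y) = y := by
    intro y
    ext i
    let w : EuclideanSpace ℝ (Fin n) → ℝ := fun v =>
      if h : v ∈ e then refCoord y (u.symm ⟨v, h⟩) else 0
    have hw : ∀ j, w (u j).1 = refCoord y j := fun j => by simp [w]
    have hP : P y = ∑ v ∈ e, w v • v := by
      rw [hsum]; exact Finset.sum_congr rfl fun j _ => by rw [hw]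
    have h1 : ∑ v ∈ e, w v = 1 := by
      rw [hsum, ← sum_refCoord y]; exact Finset.sum_congr rfl fun j _ => hw j
    change bary s (u i.succ).1 (P y) = y i
    rw [hP, bary_sum_smul hs hes h1 (u i.succ).2, hw]
    simp [refCoord]
  have hPmem : ∀ y ∈ refSimplex d, P y ∈ hull e := fun y hy =>
    (convex_hull e).sum_mem (fun j _ => refCoord_nonneg hy j) (sum_refCoord y)
      fun j _ => subset_convexHull ℝ _ (u j).2
  have hTx : ∀ x ∈ hull e, ∀ j, refCoord (T x) j = bary s (u j).1 x := by
    intro x hx j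
    refine Fin.cases ?_ (fun i => ?_) j
    · have := sum_bary hs hes hx
      rw [hsum, Fin.sum_univ_succ] at this
      simp only [refCoord, Fin.cons_zero, T]
      linarith
    · simp [refCoord, T]
  have hPT : ∀ x ∈ hull e, P (T x) = x := by
    intro x hx
    conv_rhs => rw [← sum_bary_smul hs hes hx, hsum]
    exact Finset.sum_congr rfl fun j _ => by rw [hTx x hx]
  have hTmem : ∀ x ∈ hull e, T x ∈ refSimplex d := fun x hx =>
    ⟨fun i => bary_nonneg hs hes hx (hes (u i.succ).2), by
      have h1 := hTx x hx 0
      have h2 := bary_nonneg hs hes hx (hes (u 0).2)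
      simp only [refCoord, Fin.cons_zero] at h1
      linarith⟩
  -- This constant may depend on the face: it serves only to show that the face has finite measure.
  have hPlip : ∃ K' : NNReal, LipschitzWith K' P := by
    have hA : ∀ y, P y = (u 0).1 + (∑ i : Fin d, (EuclideanSpace.proj i :
        EuclideanSpace ℝ (Fin d) →L[ℝ] ℝ).smulRight ((u i.succ).1 - (u 0).1)) y := by
      intro y
      have hproj (i : Fin d) : (EuclideanSpace.proj i : EuclideanSpace ℝ (Fin d) →L[ℝ] ℝ) y =
          y i := rfl
      simp only [P, Fin.sum_univ_succ, refCoord, Fin.cons_zero, Fin.cons_succ, sub_smul, one_smul,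
        sum_apply, ContinuousLinearMap.smulRight_apply, hproj,
        smul_sub, Finset.sum_sub_distrib, Finset.sum_smul]
      abel
    refine ⟨_, LipschitzWith.of_dist_le_mul (K := ‖∑ i : Fin d, (EuclideanSpace.proj i :
        EuclideanSpace ℝ (Fin d) →L[ℝ] ℝ).smulRight ((u i.succ).1 - (u 0).1)‖₊) fun x y => ?_⟩
    rw [hA, hA, dist_add_left]
    exact (ContinuousLinearMap.lipschitz _).dist_le_mul x y
  have hfin : (μHE[d] : Measure (EuclideanSpace ℝ (Fin n))) (hull e) < ⊤ := by
    obtain ⟨K', hK'⟩ := hPlip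
    have hsub : hull e ⊆ P '' refSimplex d := fun x hx => ⟨T x, hTmem x hx, hPT x hx⟩
    refine (measure_mono hsub).trans_lt
      ((euclideanHausdorffMeasure_image_le hK' d _).trans_lt ?_)
    rw [EuclideanSpace.euclideanHausdorffMeasure_eq_volume]
    have := (isCompact_refSimplex d).measure_lt_top (μ := volume)
    finiteness
  let c : (Fin (d + 1) →₀ ℕ) → ℝ := fun α =>
    MvPolynomial.eval (fun i => ∑ v : Fin (d + 1), nodeCoord r α v * (u v).1 i) p
  have hexp : ∀ y, MvPolynomial.eval (fun i => P y i) p =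
      ∑ α ∈ I, c α * shape r α (refCoord y) := by
    intro y
    have := eval_eq_sum_shape Finset.univ hr (fun v i => (u v).1 i) hp (sum_refCoord y)
    rw [← this]
    congr 2
    ext i
    simp [P]
  obtain ⟨J, hJ⟩ : ∃ J, J = ∫ x in hull e, (MvPolynomial.eval (fun i => x i) p) ^ 2 ∂μHE[d] :=
    ⟨_, rfl⟩
  have hcont : Continuous fun y => (∑ α ∈ I, c α * shape r α (refCoord (d := d) y)) ^ 2 :=
    (continuous_finsetSum _ fun α _ => continuous_const.mul
      ((continuous_shape r α).comp (continuous_refCoord d))).pow 2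
  have hint : ∫ y in refSimplex d, (∑ α ∈ I, c α * shape r α (refCoord y)) ^ 2 ≤
      ((d + 1) * K) ^ d * J := by
    have h := integral_le_of_lipschitz hT (isCompact_hull e) hfin
      (B := refSimplex d) (fun y hy => ⟨P y, hPmem y hy, hTP y⟩)
      hcont fun y => sq_nonneg _
    rw [Real.coe_toNNReal _ (by positivity)] at h
    refine h.trans_eq ?_
    rw [hJ]
    congr 1
    refine setIntegral_congr_fun (isClosed_hull e).measurableSet fun x hx => ?_
    simp only [← hexp, hPT x hx]
  have hJ0 : 0 ≤ J := hJ ▸ integral_nonneg fun x => sq_nonneg _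
  have hcoef : ∑ α ∈ I, c α ^ 2 ≤ N * (C * (((d + 1) * K) ^ d * J)) := by
    rw [hN, ← nsmul_eq_mul]
    exact Finset.sum_le_card_nsmul _ _ _ fun α hα =>
      (hCI c α hα).trans (mul_le_mul_of_nonneg_left hint hC.le)
  have hshape : ∑ α ∈ I, shape r α (refCoord (T x)) ^ 2 ≤ N * ((r : ℝ) ^ r) ^ 2 := by
    rw [hN, ← nsmul_eq_mul]
    refine Finset.sum_le_card_nsmul _ _ _ fun α hα => ?_
    rw [← sq_abs]
    refine pow_le_pow_left₀ (abs_nonneg _) (abs_shape_le hr hα (fun v _ => ?_) fun v _ => ?_) 2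
    · rw [hTx x hx]; exact bary_nonneg hs hes hx (hes (u v).2)
    · rw [hTx x hx]; exact bary_le_one hs hes hx (hes (u v).2)
  have hmain : (MvPolynomial.eval (fun i => x i) p) ^ 2 ≤
      (N * (C * (((d + 1) * K) ^ d * J))) * (N * ((r : ℝ) ^ r) ^ 2) := by
    have h := hexp (T x)
    rw [hPT x hx] at h
    rw [h]
    refine (Finset.sum_mul_sq_le_sq_mul_sq _ _ _).trans ?_
    exact mul_le_mul hcoef hshape (Finset.sum_nonneg fun _ _ => sq_nonneg _) (by positivity)
  rw [← hJ]
  refine hmain.trans ?_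
  have hfac : (N * (C * (((d + 1) * K) ^ d * J))) * (N * ((r : ℝ) ^ r) ^ 2) =
      (N * C) * (N * ((r : ℝ) ^ r) ^ 2) * ((d + 1) ^ d * K ^ d * J) := by
    rw [mul_pow]; ring
  rw [hfac]
  calc _ ≤ (N * C + 1) * (N * ((r : ℝ) ^ r) ^ 2 + 1) *
        ((d + 1) ^ d * K ^ d * J) := by
        refine mul_le_mul_of_nonneg_right ?_ (by positivity)
        exact mul_le_mul (le_add_of_nonneg_right zero_le_one)
          (le_add_of_nonneg_right zero_le_one) (by positivity) (by positivity)
    _ = _ := by ring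

end FaceBound
end NitscheHybrid
namespace NitscheHybrid

/-! ### Inverse estimates through derivative bounds -/

section DerivBounds

variable {V : Type*} [NormedAddCommGroup V] [NormedSpace ℝ V]

/-- `f` is smooth and its derivatives at `x` grow at most like `A * K ^ k`. -/
def HasDerivBounds (f : V → ℝ) (x : V) (A K : ℝ) : Prop :=
  ContDiff ℝ ∞ f ∧ ∀ k : ℕ, ‖iteratedFDeriv ℝ k f x‖ ≤ A * K ^ k

theorem HasDerivBounds.affine {f : V → ℝ} {x : V} {A K : ℝ} (L : V →L[ℝ] ℝ) (c : ℝ)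
    (hf : ∀ y, f y = L y + c) (hx : |f x| ≤ A) (hL : ‖L‖ ≤ A * K) (hA : 0 ≤ A) (hK : 0 ≤ K) :
    HasDerivBounds f x A K := by
  obtain rfl : f = fun y => L y + c := funext hf
  have hfd : fderiv ℝ (fun y => L y + c) = fun _ => L := by
    ext1 y
    rw [fderiv_add_const, L.fderiv]
  refine ⟨L.contDiff.add contDiff_const, fun k => ?_⟩
  match k with
  | 0 => simpa using hx
  | 1 => rw [← norm_iteratedFDeriv_fderiv, hfd]; simpa using hL
  | k + 2 =>
    rw [← norm_iteratedFDeriv_fderiv, hfd, iteratedFDeriv_succ_const]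
    simp only [Pi.zero_apply, norm_zero]
    positivity

/-- The Leibniz sum of the bounds is exactly a binomial expansion, so amplitudes multiply and rates
add, with no further constant. -/
theorem HasDerivBounds.mul {f g : V → ℝ} {x : V} {A B K M : ℝ} (hf : HasDerivBounds f x A K)
    (hg : HasDerivBounds g x B M) : HasDerivBounds (fun y => f y * g y) x (A * B) (K + M) := by
  refine ⟨hf.1.mul hg.1, fun k => ?_⟩
  refine (norm_iteratedFDeriv_mul_le hf.1 hg.1 x (n := k) (by exact_mod_cast le_top)).trans ?_
  rw [add_pow, Finset.mul_sum]
  refine Finset.sum_le_sum fun i _ => ?_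
  calc _ = (k.choose i : ℝ) * (‖iteratedFDeriv ℝ i f x‖ * ‖iteratedFDeriv ℝ (k - i) g x‖) := by
        ring
    _ ≤ (k.choose i : ℝ) * ((A * K ^ i) * (B * M ^ (k - i))) := by
        refine mul_le_mul_of_nonneg_left ?_ (by positivity)
        exact mul_le_mul (hf.2 i) (hg.2 _) (norm_nonneg _) ((norm_nonneg _).trans (hf.2 i))
    _ = _ := by ring

theorem HasDerivBounds.prod {κ : Type*} (u : Finset κ) {f : κ → V → ℝ} {x : V} {A K : κ → ℝ}
    (h : ∀ k ∈ u, HasDerivBounds (f k) x (A k) (K k)) :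
    HasDerivBounds (fun y => ∏ k ∈ u, f k y) x (∏ k ∈ u, A k) (∑ k ∈ u, K k) := by
  classical
  induction u using Finset.induction_on with
  | empty =>
    simpa using HasDerivBounds.affine (f := fun _ : V => (1 : ℝ)) (x := x) (A := 1) (K := 0) 0 1
      (by simp) (by simp) (by simp) zero_le_one le_rfl
  | insert k u hk ih =>
    simp only [Finset.prod_insert hk, Finset.sum_insert hk]
    exact (h k (by simp)).mul (ih fun j hj => h j (by simp [hj]))

theorem HasDerivBounds.sum {κ : Type*} (u : Finset κ) {f : κ → V → ℝ} {x : V} {A K : ℝ}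
    {c : κ → ℝ} {B : ℝ} (hc : ∀ k ∈ u, |c k| ≤ B)
    (h : ∀ k ∈ u, HasDerivBounds (f k) x A K) :
    HasDerivBounds (fun y => ∑ k ∈ u, c k * f k y) x (u.card * (B * A)) K := by
  have hcd : ∀ k ∈ u, ContDiff ℝ ∞ fun y => c k * f k y := fun k hk => contDiff_const.mul (h k hk).1
  refine ⟨ContDiff.sum hcd, fun m => ?_⟩
  rw [iteratedFDeriv_fun_sum_apply fun k hk =>
    ((hcd k hk).of_le (by exact_mod_cast le_top)).contDiffAt]
  refine (norm_sum_le _ _).trans ?_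
  have hk : ∀ k ∈ u, ‖iteratedFDeriv ℝ m (fun y => c k * f k y) x‖ ≤ B * A * K ^ m := by
    intro k hk
    have : (fun y => c k * f k y) = c k • f k := rfl
    rw [this, iteratedFDeriv_const_smul_apply
      (((h k hk).1.of_le (by exact_mod_cast le_top)).contDiffAt), norm_smul, Real.norm_eq_abs,
      mul_assoc]
    exact mul_le_mul (hc k hk) ((h k hk).2 m) (norm_nonneg _) ((abs_nonneg _).trans (hc k hk))
  refine (Finset.sum_le_card_nsmul _ _ _ hk).trans_eq ?_
  rw [nsmul_eq_mul]; ring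

variable {n : ℕ}

/-- Each of the `r` affine factors has amplitude `r` and rate `K`; multiplying them gives `r ^ r`
and `r * K`. -/
theorem hasDerivBounds_shape {s : Finset (EuclideanSpace ℝ (Fin n))} (hs : IsCell s) {r : ℕ}
    (hr : 1 ≤ r) {K : ℝ} (hK : 0 ≤ K)
    (hlin : ∀ v ∈ s, ∀ u : EuclideanSpace ℝ (Fin n), |(bary s v).linear u| ≤ K * ‖u‖)
    {α : EuclideanSpace ℝ (Fin n) →₀ ℕ} (hα : α ∈ latticeIndices s r)
    {x : EuclideanSpace ℝ (Fin n)} (hx : x ∈ hull s) :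
    HasDerivBounds (fun y => shape r α fun v => bary s v y) x ((r : ℝ) ^ r) (r * K) := by
  rw [mem_latticeIndices] at hα
  have hsum : ∑ v ∈ α.support, α v = r := by
    rw [← hα.1]
    exact Finset.sum_subset hα.2 fun v _ hv => Finsupp.notMem_support_iff.1 hv
  have hr1 : (1 : ℝ) ≤ r := by exact_mod_cast hr
  have h := HasDerivBounds.prod (V := EuclideanSpace ℝ (Fin n)) (x := x) α.support
    (f := fun v y => ∏ j ∈ Finset.range (α v), ((r : ℝ) * bary s v y - j) / (j + 1))
    (A := fun v => (r : ℝ) ^ α v) (K := fun v => α v * K) fun v hv => by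
      have hvs := hα.2 hv
      have h := HasDerivBounds.prod (V := EuclideanSpace ℝ (Fin n)) (x := x) (Finset.range (α v))
        (f := fun j y => ((r : ℝ) * bary s v y - j) / (j + 1))
        (A := fun _ => (r : ℝ)) (K := fun _ => K) fun j hj => by
          have hjr : (j : ℝ) ≤ r := by
            have h2 : α v ≤ r :=
              hsum ▸ Finset.single_le_sum (f := α) (fun _ _ => Nat.zero_le _) hv
            have := Finset.mem_range.1 hj
            exact_mod_cast (by omega : j ≤ r)
          have hj0 : (0 : ℝ) ≤ j := by positivity
          have hfrac : (r : ℝ) / (j + 1) ≤ r := div_le_self (by positivity) (by linarith)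
          refine HasDerivBounds.affine
            (((r : ℝ) / (j + 1)) • LinearMap.toContinuousLinearMap (bary s v).linear)
            ((r * bary s v 0 - j) / (j + 1)) (fun y => ?_) ?_ ?_ (by positivity) hK
          · have : bary s v y = (bary s v).linear y + bary s v 0 := by
              simpa using (bary s v).map_vadd 0 y
            rw [this]
            simp only [smul_apply, LinearMap.coe_toContinuousLinearMap',
              smul_eq_mul]
            ring
          · have a0 := bary_nonneg hs subset_rfl hx hvs
            have a1 := bary_le_one hs subset_rfl hx hvs
            rw [abs_div, abs_of_pos (by positivity : (0 : ℝ) < j + 1), div_le_iff₀ (by positivity),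
              abs_le]
            constructor <;> nlinarith
          · refine ContinuousLinearMap.opNorm_le_bound _ (by positivity) fun u => ?_
            simp only [smul_apply, LinearMap.coe_toContinuousLinearMap',
              smul_eq_mul, norm_mul, Real.norm_eq_abs]
            rw [abs_of_nonneg (by positivity : (0 : ℝ) ≤ r / (j + 1)), mul_assoc]
            exact mul_le_mul hfrac (hlin v hvs u) (abs_nonneg _) (by positivity)
      simpa using h
  have hA : ∏ v ∈ α.support, (r : ℝ) ^ α v = (r : ℝ) ^ r := by
    rw [Finset.prod_pow_eq_pow_sum, hsum]
  have hB : ∑ v ∈ α.support, (α v : ℝ) * K = r * K := by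
    rw [← Finset.sum_mul, ← Nat.cast_sum, hsum]
  rw [hA, hB] at h
  exact h

/-- Inverse estimate for a polynomial given by its nodal values. -/
theorem norm_iteratedFDeriv_cellExt_le {s : Finset (EuclideanSpace ℝ (Fin n))} (hs : IsCell s)
    {r : ℕ} (hr : 1 ≤ r) {K : ℝ} (hK : 0 ≤ K)
    (hlin : ∀ v ∈ s, ∀ u : EuclideanSpace ℝ (Fin n), |(bary s v).linear u| ≤ K * ‖u‖)
    {c : (EuclideanSpace ℝ (Fin n) →₀ ℕ) → ℝ} {B : ℝ}
    (hc : ∀ α ∈ latticeIndices s r, |c α| ≤ B) (m : ℕ)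
    {x : EuclideanSpace ℝ (Fin n)} (hx : x ∈ hull s) :
    ‖iteratedFDeriv ℝ m (cellExt r s c) x‖ ≤
      (n + 1 + r - 1).choose r * (B * (r : ℝ) ^ r) * (r * K) ^ m := by
  have h := (HasDerivBounds.sum (latticeIndices s r) hc fun α hα =>
    hasDerivBounds_shape hs hr hK hlin hα hx).2 m
  rwa [card_latticeIndices, hs.1] at h

theorem dist_le_size {s : Finset (EuclideanSpace ℝ (Fin n))} {x y : EuclideanSpace ℝ (Fin n)}
    (hx : x ∈ hull s) (hy : y ∈ hull s) : dist x y ≤ size s :=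
  Metric.dist_le_diam_of_mem (isCompact_hull s).isBounded hx hy

theorem size_nonneg (s : Finset (EuclideanSpace ℝ (Fin n))) : 0 ≤ size s :=
  Metric.diam_nonneg

theorem size_pos (hn : 1 ≤ n) {s : Finset (EuclideanSpace ℝ (Fin n))} (hs : IsCell s) :
    0 < size s := by
  obtain ⟨x, hx, y, hy, hxy⟩ := Finset.one_lt_card.1 (by rw [hs.1]; omega : 1 < s.card)
  exact (dist_pos.2 hxy).trans_le
    (dist_le_size (subset_convexHull ℝ _ hx) (subset_convexHull ℝ _ hy))

theorem measureReal_hull_le (s : Finset (EuclideanSpace ℝ (Fin n))) :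
    MeasureTheory.volume.real (hull s) ≤
      size s ^ n * MeasureTheory.volume.real (Metric.ball (0 : EuclideanSpace ℝ (Fin n)) 1) := by
  rcases (hull s).eq_empty_or_nonempty with h | ⟨x, hx⟩
  · rw [h]
    simp only [MeasureTheory.measureReal_empty]
    have := size_nonneg s
    positivity
  · have hsub : hull s ⊆ Metric.closedBall x (size s) := fun y hy => dist_le_size hy hx
    refine (MeasureTheory.measureReal_mono hsub
      (isCompact_closedBall x (size s)).measure_lt_top.ne).trans_eq ?_
    rw [MeasureTheory.Measure.real, MeasureTheory.Measure.addHaar_closedBall _ _ (size_nonneg s),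
      ENNReal.toReal_mul, ENNReal.toReal_ofReal (by have := size_nonneg s; positivity)]
    simp [MeasureTheory.Measure.real]

/-- Agreement on the closed simplex suffices, because the seminorm integrates over the interior,
where the two functions agree near each point. There are at most `n ^ m` multi-indices. -/
theorem seminormSq_le {m : ℕ} {s : Finset (EuclideanSpace ℝ (Fin n))}
    {w f : EuclideanSpace ℝ (Fin n) → ℝ} (hwf : Set.EqOn w f (hull s)) {M : ℝ}
    (hM : ∀ x ∈ hull s, ‖iteratedFDeriv ℝ m f x‖ ≤ M) :
    seminormSq m s w ≤ (n : ℝ) ^ m * (M ^ 2 * MeasureTheory.volume.real (hull s)) := by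
  classical
  have hfin : MeasureTheory.volume (interior (hull s)) < ⊤ :=
    (MeasureTheory.measure_mono interior_subset).trans_lt (isCompact_hull s).measure_lt_top
  have hterm : ∀ α : Fin m → Fin n, ∫ x in interior (hull s),
      (iteratedFDeriv ℝ m w x fun j => EuclideanSpace.single (α j) (1 : ℝ)) ^ 2 ≤
        M ^ 2 * MeasureTheory.volume.real (hull s) := by
    intro α
    refine (Real.le_norm_self _).trans ((MeasureTheory.norm_setIntegral_le_of_norm_le_const hfin
      (C := M ^ 2) fun x hx => ?_).trans ?_)
    · have heq : w =ᶠ[nhds x] f :=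
        Filter.eventuallyEq_of_mem (isOpen_interior.mem_nhds hx) (hwf.mono interior_subset)
      rw [(Filter.EventuallyEq.iteratedFDeriv ℝ heq m).eq_of_nhds, norm_pow]
      refine pow_le_pow_left₀ (norm_nonneg _) ?_ 2
      refine (ContinuousMultilinearMap.le_opNorm _ _).trans ?_
      simpa using hM x (interior_subset hx)
    · exact mul_le_mul_of_nonneg_left
        (MeasureTheory.measureReal_mono interior_subset (isCompact_hull s).measure_lt_top.ne)
        (sq_nonneg M)
  unfold seminormSq
  refine (Finset.sum_le_card_nsmul _ _ _ fun α _ => hterm α).trans ?_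
  rw [nsmul_eq_mul]
  refine mul_le_mul_of_nonneg_right ?_
    (mul_nonneg (sq_nonneg M) MeasureTheory.measureReal_nonneg)
  refine (Nat.cast_le.2 (Finset.card_filter_le _ _)).trans ?_
  simp

end DerivBounds
end NitscheHybrid
namespace NitscheHybrid

/-! ### Packing of cells, and interface faces -/

section Packing

open MeasureTheory

variable {n : ℕ}

/-- Moving slightly from a point of `U` towards `v` stays in `U` but makes the coordinate of `v`
positive, while that coordinate vanishes on the face. -/
theorem not_nonempty_open_subset_hull {s t : Finset (EuclideanSpace ℝ (Fin n))} (hs : IsCell s)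
    (hts : t ⊆ s) {v : EuclideanSpace ℝ (Fin n)} (hv : v ∈ s) (hvt : v ∉ t)
    {U : Set (EuclideanSpace ℝ (Fin n))} (hU : IsOpen U) (hUt : U ⊆ hull t) : U = ∅ := by
  by_contra hne
  obtain ⟨x, hx⟩ := Set.nonempty_iff_ne_empty.2 hne
  have hcont : Continuous fun a : ℝ => AffineMap.lineMap x v a := AffineMap.lineMap_continuous
  have hmem : ∀ᶠ a : ℝ in nhds 0, AffineMap.lineMap x v a ∈ U :=
    hcont.continuousAt.eventually (by simpa using hU.mem_nhds hx)
  obtain ⟨a, ha, ha0⟩ := ((hmem.filter_mono nhdsWithin_le_nhds).and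
    (self_mem_nhdsWithin : ∀ᶠ a : ℝ in nhdsWithin 0 (Set.Ioi 0), a ∈ Set.Ioi 0)).exists
  have h1 := bary_eq_zero hs hts (hUt ha) hv hvt
  rw [AffineMap.apply_lineMap, bary_self hs hv, bary_eq_zero hs hts (hUt hx) hv hvt] at h1
  simp [AffineMap.lineMap_apply] at h1
  exact (ne_of_gt ha0) h1

theorem Triangulation.disjoint_of_isOpen (T : Triangulation n)
    {s t : Finset (EuclideanSpace ℝ (Fin n))} (hs : s ∈ T.cells) (ht : t ∈ T.cells) (hst : s ≠ t)
    {U U' : Set (EuclideanSpace ℝ (Fin n))} (hU : IsOpen U) (hU' : IsOpen U')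
    (hUs : U ⊆ hull s) (hUt : U' ⊆ hull t) : Disjoint U U' := by
  classical
  obtain ⟨v, hv, hvt⟩ : ∃ v ∈ s, v ∉ s ∩ t := by
    by_contra! h
    have hsub : s ⊆ t := fun v hv => (Finset.mem_inter.1 (h v hv)).2
    exact hst (Finset.eq_of_subset_of_card_le hsub (by rw [T.card_eq s hs, T.card_eq t ht]))
  rw [Set.disjoint_iff_inter_eq_empty]
  refine not_nonempty_open_subset_hull (T.isCell hs) Finset.inter_subset_left hv hvt
    (hU.inter hU') ?_
  rw [← T.hull_inter hs ht]
  exact Set.inter_subset_inter hUs hUt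

/-- Only boundedly many cells with a large inscribed ball fit into a given ball. -/
theorem Triangulation.card_mul_pow_le (T : Triangulation n)
    {F : Finset (Finset (EuclideanSpace ℝ (Fin n)))} (hF : F ⊆ T.cells)
    {x : EuclideanSpace ℝ (Fin n)} {R δ : ℝ} (hR : 0 ≤ R) (hδ : 0 < δ)
    (hball : ∀ s ∈ F, ∃ c, Metric.closedBall c δ ⊆ hull s)
    (hsub : ∀ s ∈ F, hull s ⊆ Metric.closedBall x R) : (F.card : ℝ) * δ ^ n ≤ R ^ n := by
  choose! c hc using hball
  have hdisj : (F : Set (Finset (EuclideanSpace ℝ (Fin n)))).PairwiseDisjoint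
      fun s => Metric.ball (c s) δ := fun s hs t ht hst =>
    T.disjoint_of_isOpen (hF hs) (hF ht) hst Metric.isOpen_ball Metric.isOpen_ball
      (Metric.ball_subset_closedBall.trans (hc s hs))
      (Metric.ball_subset_closedBall.trans (hc t ht))
  have h := measure_biUnion_finset (μ := (volume : Measure (EuclideanSpace ℝ (Fin n)))) hdisj
    fun s _ => measurableSet_ball
  have hle : volume (⋃ s ∈ F, Metric.ball (c s) δ) ≤ volume (Metric.closedBall x R) :=
    measure_mono (Set.iUnion₂_subset fun s hs =>
      (Metric.ball_subset_closedBall.trans (hc s hs)).trans (hsub s hs))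
  rw [h, Measure.addHaar_closedBall _ _ hR] at hle
  have hb : ∀ s, volume (Metric.ball (c s) δ) = ENNReal.ofReal (δ ^ n) *
      volume (Metric.ball (0 : EuclideanSpace ℝ (Fin n)) 1) := fun s => by
    rw [Measure.addHaar_ball_of_pos _ _ hδ]
    simp
  simp only [hb, Finset.sum_const, nsmul_eq_mul, finrank_euclideanSpace, Fintype.card_fin] at hle
  rw [← mul_assoc] at hle
  have h0 : volume (Metric.ball (0 : EuclideanSpace ℝ (Fin n)) 1) ≠ 0 :=
    (Metric.measure_ball_pos _ _ one_pos).ne'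
  have htop : volume (Metric.ball (0 : EuclideanSpace ℝ (Fin n)) 1) ≠ ⊤ :=
    measure_ball_lt_top.ne
  rw [ENNReal.mul_le_mul_iff_left h0 htop, ← ENNReal.ofReal_natCast,
    ← ENNReal.ofReal_mul (by positivity)] at hle
  exact (ENNReal.ofReal_le_ofReal_iff (by positivity)).1 hle

theorem mem_interfaceFaces {T : Triangulation n} {Γ : Set (EuclideanSpace ℝ (Fin n))}
    {e : Finset (EuclideanSpace ℝ (Fin n))} :
    e ∈ T.interfaceFaces Γ ↔ (∃ s ∈ T.cells, e ⊆ s ∧ e.card = n) ∧ hull e ⊆ closure Γ := by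
  simp [Triangulation.interfaceFaces, Finset.mem_powersetCard]

theorem mem_interfaceCells {T : Triangulation n} {Γ : Set (EuclideanSpace ℝ (Fin n))}
    {s : Finset (EuclideanSpace ℝ (Fin n))} :
    s ∈ T.interfaceCells Γ ↔ s ∈ T.cells ∧ (hull s ∩ Γ).Nonempty := by
  simp [Triangulation.interfaceCells]

/-- A face that contains the barycenter of another face contains that face. -/
theorem Triangulation.subset_of_barycenter_mem (T : Triangulation n)
    {s s' e e' : Finset (EuclideanSpace ℝ (Fin n))} (hs : s ∈ T.cells) (hs' : s' ∈ T.cells)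
    (hes : e ⊆ s) (hes' : e' ⊆ s') (he : e.Nonempty)
    (hx : ∑ v ∈ e, (e.card : ℝ)⁻¹ • v ∈ hull e') : e ⊆ e' := by
  classical
  have hcard : (0 : ℝ) < e.card := by exact_mod_cast he.card_pos
  have hw : ∑ _v ∈ e, (e.card : ℝ)⁻¹ = 1 := by
    rw [Finset.sum_const, nsmul_eq_mul, mul_inv_cancel₀ hcard.ne']
  set x := ∑ v ∈ e, (e.card : ℝ)⁻¹ • v with hxdef
  have hxe : x ∈ hull e := mem_hull_iff.2 ⟨fun _ => (e.card : ℝ)⁻¹, fun _ _ => by positivity, hw, rfl⟩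
  have hxst : x ∈ hull (s ∩ s') :=
    T.hull_inter hs hs' ▸ ⟨hull_mono hes hxe, hull_mono hes' hx⟩
  intro v hv
  have hpos : bary s v x ≠ 0 := by
    rw [hxdef, bary_sum_smul (T.isCell hs) hes (w := fun _ => (e.card : ℝ)⁻¹) hw hv]
    positivity
  have hvst : v ∈ s ∩ s' := by
    by_contra h
    exact hpos (bary_eq_zero (T.isCell hs) Finset.inter_subset_left hxst (hes hv) h)
  rw [bary_eq_bary (T.isCell hs) Finset.inter_subset_left (T.isCell hs')
    Finset.inter_subset_right hxst hvst] at hpos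
  by_contra h
  exact hpos (bary_eq_zero (T.isCell hs') hes' hx (Finset.mem_inter.1 hvst).2 h)

/-- A face in the closure of `Γ` meets `Γ`. -/
theorem Triangulation.hull_inter_nonempty (T : Triangulation n) (hn : 1 ≤ n)
    {Γ : Set (EuclideanSpace ℝ (Fin n))} (hfit : Γ ⊆ ⋃ e ∈ T.interfaceFaces Γ, hull e)
    {e : Finset (EuclideanSpace ℝ (Fin n))} (he : e ∈ T.interfaceFaces Γ) :
    (hull e ∩ Γ).Nonempty := by
  classical
  obtain ⟨⟨s, hs, hes, hcard⟩, hcl⟩ := mem_interfaceFaces.1 he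
  have hne : e.Nonempty := Finset.card_pos.1 (by omega)
  have hc0 : (0 : ℝ) < e.card := by exact_mod_cast hne.card_pos
  set x := ∑ v ∈ e, (e.card : ℝ)⁻¹ • v with hx
  have hxe : x ∈ hull e := mem_hull_iff.2 ⟨fun _ => (e.card : ℝ)⁻¹, fun _ _ => by positivity, by
    rw [Finset.sum_const, nsmul_eq_mul, mul_inv_cancel₀ hc0.ne'], rfl⟩
  -- The other interface faces form a closed set that misses the barycenter of `e`. Points of `Γ`
  -- close enough to the barycenter avoid that set, and since faces cover `Γ` they lie on `e`.
  have hclosed : IsClosed (⋃ e' ∈ (T.interfaceFaces Γ).erase e, hull e') :=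
    (Finset.finite_toSet _).isClosed_biUnion fun e' _ => isClosed_hull e'
  have hxn : x ∉ ⋃ e' ∈ (T.interfaceFaces Γ).erase e, hull e' := by
    simp only [Set.mem_iUnion, not_exists]
    intro e' he' hxe'
    obtain ⟨hne', he'⟩ := Finset.mem_erase.1 he'
    obtain ⟨⟨s', hs', hes', hcard'⟩, -⟩ := mem_interfaceFaces.1 he'
    have hsub := T.subset_of_barycenter_mem hs hs' hes hes' hne hxe'
    exact hne' (Finset.eq_of_subset_of_card_le hsub (by omega)).symm
  obtain ⟨y, hy, hyΓ⟩ := mem_closure_iff.1 (hcl hxe) _ hclosed.isOpen_compl hxn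
  obtain ⟨e', he', hye'⟩ := Set.mem_iUnion₂.1 (hfit hyΓ)
  by_cases h : e' = e
  · exact ⟨y, h ▸ hye', hyΓ⟩
  · exact absurd (Set.mem_biUnion (Finset.mem_erase.2 ⟨h, he'⟩) hye') hy

/-- The largest size of a simplex of `T` that touches `Γ`. -/
noncomputable def interfaceSize (T : Triangulation n) (Γ : Set (EuclideanSpace ℝ (Fin n))) : ℝ :=
  sSup {d | ∃ t ∈ T.interfaceCells Γ, d = size t}

theorem size_le_interfaceSize {T : Triangulation n} {Γ : Set (EuclideanSpace ℝ (Fin n))}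
    {s : Finset (EuclideanSpace ℝ (Fin n))} (hs : s ∈ T.interfaceCells Γ) :
    size s ≤ interfaceSize T Γ := by
  refine le_csSup (Set.Finite.bddAbove ?_) ⟨s, hs, rfl⟩
  refine ((T.interfaceCells Γ).finite_toSet.image size).subset ?_
  rintro _ ⟨t, ht, rfl⟩
  exact ⟨t, ht, rfl⟩

/-- Every cell that contains `e` touches `Γ`, so its size is among those whose supremum is
`interfaceSize`. -/
theorem adjacentSize_pos_and_le {T : Triangulation n} (hn : 1 ≤ n)
    {Γ e : Set (EuclideanSpace ℝ (Fin n))} (heΓ : (e ∩ Γ).Nonempty)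
    {s : Finset (EuclideanSpace ℝ (Fin n))} (hs : s ∈ T.cells) (hes : e ⊆ hull s) :
    0 < adjacentSize T e ∧ adjacentSize T e ≤ interfaceSize T Γ := by
  have hle : ∀ d ∈ {d | ∃ s ∈ T.cells, e ⊆ hull s ∧ d = size s}, d ≤ interfaceSize T Γ := by
    rintro _ ⟨t, ht, het, rfl⟩
    exact size_le_interfaceSize (mem_interfaceCells.2 ⟨ht, heΓ.mono
      (Set.inter_subset_inter_left _ het)⟩)
  refine ⟨(size_pos hn (T.isCell hs)).trans_le (le_csSup ⟨_, hle⟩ ⟨s, hs, hes, rfl⟩), ?_⟩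
  exact csSup_le ⟨_, s, hs, hes, rfl⟩ hle

/-- Every piece of the cut mesh is a fine face lying in a coarse simplex when the fine interface
mesh is a subgrid of the coarse one. -/
theorem exists_coarse_cell_of_isSubgrid {D : Set (EuclideanSpace ℝ (Fin n))}
    {Th TH : Triangulation n} (hsub : IsSubgrid D Th TH)
    {e : Finset (EuclideanSpace ℝ (Fin n))} (he : e ∈ Th.interfaceFaces (interface D Th)) :
    ∃ S ∈ TH.cells, hull e ⊆ hull S := by
  classical
  have hmem : hull e ∈ cutMesh D Th TH := by
    rw [hsub]
    exact Finset.mem_image_of_mem _ he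
  simp only [cutMesh, Finset.mem_filter, Finset.mem_image, Finset.mem_product] at hmem
  obtain ⟨⟨⟨e', E⟩, ⟨-, hE⟩, heq⟩, -⟩ := hmem
  obtain ⟨⟨S, hS, hES, -⟩, -⟩ := mem_interfaceFaces.1 hE
  refine ⟨S, hS, ?_⟩
  rw [← heq]
  exact Set.inter_subset_right.trans (hull_mono hES)

end Packing
end NitscheHybrid
namespace NitscheHybrid

/-! ### Continuous piecewise polynomials are in $H^1$ -/

section Sobolev

open MeasureTheory Filter Topology

/-- A continuous function that is Lipschitz on each set of a finite closed cover of a normed space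
is Lipschitz. -/
theorem lipschitzWith_of_finite_cover {V ι : Type*} [NormedAddCommGroup V] [NormedSpace ℝ V]
    [Finite ι] {F : V → ℝ} (hF : Continuous F) {A : ι → Set V} (hA : ∀ i, IsClosed (A i))
    (hcover : ∀ x, ∃ i, x ∈ A i) {L : NNReal} (hL : ∀ i, LipschitzOnWith L F (A i)) :
    LipschitzWith L F := by
  refine LipschitzWith.of_le_add_mul L fun y x => ?_
  let γ : ℝ → V := AffineMap.lineMap x y
  have hγ : Continuous γ := AffineMap.lineMap_continuous
  have hdist : ∀ a b : ℝ, dist (γ a) (γ b) = |a - b| * dist x y := fun a b => by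
    simp only [γ, dist_lineMap_lineMap, Real.dist_eq]
  have h := image_le_of_liminf_slope_right_le_deriv_boundary (f := F ∘ γ) (a := 0) (b := 1)
    (hF.comp hγ).continuousOn (B := fun t => F x + L * dist x y * t)
    (B' := fun _ => L * dist x y) (by simp [γ]) (by fun_prop)
    (fun t _ => by
      simpa using (((hasDerivAt_id t).const_mul (L * dist x y)).const_add (F x)).hasDerivWithinAt)
    fun t _ r hr => ?_
  · have h1 := h (Set.right_mem_Icc.2 zero_le_one)
    simpa [γ, dist_comm] using h1
  -- Bounding the right slope frequently is enough. By finiteness one set `A i` contains `γ z` for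
  -- points `z` arbitrarily close to `t` on the right; being closed it contains `γ t` too, so its
  -- Lipschitz bound applies to the pair.
  · have hex : ∃ᶠ z in 𝓝[>] t, ∃ i, γ z ∈ A i :=
      (Eventually.of_forall fun z => hcover (γ z)).frequently
    obtain ⟨i, hi⟩ := frequently_exists.1 hex
    have hti : γ t ∈ A i := (hA i).mem_of_frequently_of_tendsto hi
      (hγ.continuousAt.mono_left nhdsWithin_le_nhds)
    refine (hi.and_eventually self_mem_nhdsWithin).mono fun z hz => ?_
    obtain ⟨hzi, hzt⟩ := hz
    have hzt : 0 < z - t := sub_pos.2 hzt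
    refine lt_of_le_of_lt ?_ hr
    rw [slope_def_field, div_le_iff₀ hzt]
    have h1 := (hL i).dist_le_mul _ hzi _ hti
    rw [hdist, abs_of_pos hzt] at h1
    have h2 := (le_abs_self _).trans h1
    simp only [Function.comp_apply]
    linarith

variable {n : ℕ}

theorem contDiff_eval (p : MvPolynomial (Fin n) ℝ) :
    ContDiff ℝ ∞ fun x : EuclideanSpace ℝ (Fin n) => MvPolynomial.eval (fun i => x i) p := by
  simp only [MvPolynomial.eval_eq]
  fun_prop

/-- Data of a continuous piecewise polynomial function on an open set. -/
structure IsPiecewisePolynomial {ι : Type*} (D : Set (EuclideanSpace ℝ (Fin n)))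
    (A : ι → Finset (EuclideanSpace ℝ (Fin n))) (p : ι → MvPolynomial (Fin n) ℝ)
    (f : EuclideanSpace ℝ (Fin n) → ℝ) : Prop where
  isOpen : IsOpen D
  cover : D ⊆ ⋃ i, hull (A i)
  eq : ∀ i, ∀ x ∈ D ∩ hull (A i), f x = MvPolynomial.eval (fun j => x j) (p i)

namespace IsPiecewisePolynomial

variable {ι : Type*} [Finite ι] {D : Set (EuclideanSpace ℝ (Fin n))}
  {A : ι → Finset (EuclideanSpace ℝ (Fin n))} {p : ι → MvPolynomial (Fin n) ℝ}
  {f : EuclideanSpace ℝ (Fin n) → ℝ} (h : IsPiecewisePolynomial D A p f)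
include h

theorem continuousOn : ContinuousOn f D := by
  have hD : D = ⋃ i, D ∩ hull (A i) := by
    rw [← Set.inter_iUnion, Set.inter_eq_left.2 h.cover]
  intro x hx
  rw [ContinuousWithinAt, hD, (locallyFinite_of_finite _).nhdsWithin_iUnion, tendsto_iSup]
  intro i
  by_cases hxi : x ∈ hull (A i)
  · have hc : ContinuousWithinAt (fun x : EuclideanSpace ℝ (Fin n) =>
        MvPolynomial.eval (fun j => x j) (p i)) (D ∩ hull (A i)) x :=
      (continuous_eval (p i)).continuousWithinAt
    exact hc.congr (fun y hy => h.eq i y hy) (h.eq i x ⟨hx, hxi⟩)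
  · have hbot : 𝓝[D ∩ hull (A i)] x = ⊥ := by
      rw [← notMem_closure_iff_nhdsWithin_eq_bot]
      exact fun hmem => hxi ((isClosed_hull (A i)).closure_subset_iff.2 Set.inter_subset_right hmem)
    rw [hbot]
    exact tendsto_bot

theorem volume_lt_top : volume D < ⊤ :=
  (measure_mono h.cover).trans_lt
    (isCompact_iUnion fun i => isCompact_hull (A i)).measure_lt_top

/-- The boundary of a convex set is a null set, and there are finitely many cells. -/
theorem ae_mem_interior : ∀ᵐ x, x ∈ D → ∃ i, x ∈ interior (hull (A i)) := by
  have hnull : ∀ᵐ x : EuclideanSpace ℝ (Fin n), ∀ i, x ∉ frontier (hull (A i)) := by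
    have : Countable ι := Finite.to_countable
    exact ae_all_iff.2 fun i => measure_eq_zero_iff_ae_notMem.1
      ((convex_hull (A i)).addHaar_frontier volume)
  filter_upwards [hnull] with x hx hxD
  obtain ⟨i, hi⟩ := Set.mem_iUnion.1 (h.cover hxD)
  refine ⟨i, ?_⟩
  by_contra hni
  exact hx i ⟨subset_closure hi, hni⟩

omit [Finite ι] in
theorem eventuallyEq {i : ι} {x : EuclideanSpace ℝ (Fin n)} (hx : x ∈ D)
    (hi : x ∈ interior (hull (A i))) :
    f =ᶠ[𝓝 x] fun y => MvPolynomial.eval (fun j => y j) (p i) :=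
  eventuallyEq_of_mem (inter_mem (h.isOpen.mem_nhds hx) (isOpen_interior.mem_nhds hi))
    fun y hy => h.eq i y ⟨hy.1, interior_subset hy.2⟩

omit h [Finite ι] in
theorem exists_uniform_bound [Finite ι] {g : ι → EuclideanSpace ℝ (Fin n) → ℝ}
    (hg : ∀ i, Continuous (g i)) : ∃ M, ∀ i, ∀ x ∈ hull (A i), ‖g i x‖ ≤ M := by
  choose M hM using fun i => (isCompact_hull (A i)).exists_bound_of_continuousOn (hg i).continuousOn
  obtain ⟨M', hM'⟩ := (Set.finite_range M).bddAbove
  exact ⟨M', fun i x hx => (hM i x hx).trans (hM' ⟨i, rfl⟩)⟩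

theorem memLp : MemLp f 2 (volume.restrict D) := by
  have : IsFiniteMeasure (volume.restrict D) := ⟨by simpa using h.volume_lt_top⟩
  obtain ⟨M, hM⟩ := exists_uniform_bound (A := A) fun i => continuous_eval (p i)
  refine MemLp.of_bound (h.continuousOn.aestronglyMeasurable h.isOpen.measurableSet) M ?_
  filter_upwards [ae_restrict_mem h.isOpen.measurableSet] with x hx
  obtain ⟨i, hi⟩ := Set.mem_iUnion.1 (h.cover hx)
  rw [h.eq i x ⟨hx, hi⟩]
  exact hM i x hi

theorem memLp_fderiv (v : EuclideanSpace ℝ (Fin n)) :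
    MemLp (fun x => fderiv ℝ f x v) 2 (volume.restrict D) := by
  have : IsFiniteMeasure (volume.restrict D) := ⟨by simpa using h.volume_lt_top⟩
  obtain ⟨M, hM⟩ := exists_uniform_bound (A := A)
    (g := fun i x => fderiv ℝ (fun y : EuclideanSpace ℝ (Fin n) =>
      MvPolynomial.eval (fun j => y j) (p i)) x v) fun i =>
    ((contDiff_eval (p i)).continuous_fderiv (by simp)).clm_apply continuous_const
  refine MemLp.of_bound (measurable_fderiv_apply_const ℝ f v).aestronglyMeasurable M ?_
  filter_upwards [ae_restrict_mem h.isOpen.measurableSet, ae_restrict_of_ae h.ae_mem_interior]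
    with x hx hxi
  obtain ⟨i, hi⟩ := hxi hx
  rw [(h.eventuallyEq hx hi).fderiv_eq]
  exact hM i x (interior_subset hi)

/-- No regularity of `D` is available, so the cutoff by the test function turns `f` into a function
on the whole space. The product is smooth on each cell within the support of `φ`; the closed zero
set of the product completes the cover. -/
theorem exists_lipschitzWith_mul {φ : EuclideanSpace ℝ (Fin n) → ℝ} (hφ : ContDiff ℝ ∞ φ)
    (hφD : tsupport φ ⊆ D) : ∃ L, LipschitzWith L fun x => φ x * f x := by
  classical
  have hzero : ∀ x ∉ tsupport φ, φ x * f x = 0 := fun x hx => by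
    rw [image_eq_zero_of_notMem_tsupport hx, zero_mul]
  have hcont : Continuous fun x => φ x * f x := by
    refine continuous_iff_continuousAt.2 fun x => ?_
    by_cases hx : x ∈ tsupport φ
    · exact hφ.continuous.continuousAt.mul
        (h.continuousOn.continuousAt (h.isOpen.mem_nhds (hφD hx)))
    · have heq : (fun x => φ x * f x) =ᶠ[𝓝 x] fun _ => 0 :=
        eventuallyEq_of_mem ((isClosed_tsupport φ).isOpen_compl.mem_nhds hx) hzero
      exact continuousAt_const.congr heq.symm
  choose L hL using fun i => (hφ.mul (contDiff_eval (p i))).contDiffOn.exists_lipschitzOnWith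
    (by simp) (convex_hull (A i)) (isCompact_hull (A i))
  obtain ⟨L', hL'⟩ := (Set.finite_range L).bddAbove
  refine ⟨L', lipschitzWith_of_finite_cover (ι := Option ι) hcont
    (A := fun o => o.elim {x | φ x * f x = 0} fun i => hull (A i) ∩ tsupport φ) ?_ ?_ ?_⟩
  · rintro (_ | i)
    · exact isClosed_eq hcont continuous_const
    · exact (isClosed_hull _).inter (isClosed_tsupport φ)
  · intro x
    by_cases hx : x ∈ tsupport φ
    · obtain ⟨i, hi⟩ := Set.mem_iUnion.1 (h.cover (hφD hx))
      exact ⟨some i, hi, hx⟩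
    · exact ⟨none, hzero x hx⟩
  · rintro (_ | i)
    · refine LipschitzOnWith.of_dist_le_mul fun x hx y hy => ?_
      have hx : φ x * f x = 0 := hx
      have hy : φ y * f y = 0 := hy
      rw [hx, hy, dist_self]
      positivity
    · refine LipschitzOnWith.of_dist_le_mul fun x hx y hy => ?_
      have hx' : φ x * f x = _ := congrArg (φ x * ·) (h.eq i x ⟨hφD hx.2, hx.1⟩)
      have hy' : φ y * f y = _ := congrArg (φ y * ·) (h.eq i y ⟨hφD hy.2, hy.1⟩)
      rw [hx', hy']
      refine ((hL i).dist_le_mul x hx.1 y hy.1).trans ?_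
      gcongr
      exact hL' ⟨i, rfl⟩

theorem integral_mul_fderiv {φ : EuclideanSpace ℝ (Fin n) → ℝ} (hφ : ContDiff ℝ ∞ φ)
    (hφc : HasCompactSupport φ) (hφD : tsupport φ ⊆ D) (v : EuclideanSpace ℝ (Fin n)) :
    ∫ x in D, f x * fderiv ℝ φ x v = -∫ x in D, fderiv ℝ f x v * φ x := by
  obtain ⟨L, hL⟩ := h.exists_lipschitzWith_mul hφ hφD
  have hcs : HasCompactSupport fun x => φ x * f x := hφc.mul_right
  -- Integration by parts against the constant one: the derivative of the compactly supported
  -- Lipschitz product has integral zero. The product rule, valid almost everywhere, then gives the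
  -- weak derivative.
  have hzero := LipschitzWith.integral_lineDeriv_mul_eq (μ := volume)
    (LipschitzWith.const (1 : ℝ) : LipschitzWith 0 fun _ : EuclideanSpace ℝ (Fin n) => (1 : ℝ))
    hL hcs (-v)
  have hconst (x w : EuclideanSpace ℝ (Fin n)) (a : ℝ) :
      lineDeriv ℝ (fun _ : EuclideanSpace ℝ (Fin n) => a) x w = 0 := by
    simp [lineDeriv]
  simp only [hconst, zero_mul, integral_zero, neg_neg, mul_one] at hzero
  have hae : ∀ᵐ x, lineDeriv ℝ (fun x => φ x * f x) x v =
      f x * fderiv ℝ φ x v + fderiv ℝ f x v * φ x := by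
    filter_upwards [h.ae_mem_interior] with x hx
    by_cases hxφ : x ∈ tsupport φ
    · obtain ⟨i, hi⟩ := hx (hφD hxφ)
      have hf : DifferentiableAt ℝ f x :=
        (((contDiff_eval (p i)).differentiable (by simp)).differentiableAt).congr_of_eventuallyEq
          (h.eventuallyEq (hφD hxφ) hi)
      have hφx : DifferentiableAt ℝ φ x := (hφ.differentiable (by simp)).differentiableAt
      rw [(hφx.fun_mul hf).lineDeriv_eq_fderiv, fderiv_fun_mul hφx hf]
      simp only [add_apply, smul_apply, smul_eq_mul]
      ring
    · have h0 : φ =ᶠ[𝓝 x] fun _ => 0 := notMem_tsupport_iff_eventuallyEq.1 hxφ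
      have h1 : (fun x => φ x * f x) =ᶠ[𝓝 x] fun _ => 0 := h0.mono fun y hy => by simp [hy]
      rw [h1.lineDeriv_eq, h0.fderiv_eq, h0.eq_of_nhds]
      simp [hconst]
  rw [integral_congr_ae hae] at hzero
  have hset : ∫ x in D, (f x * fderiv ℝ φ x v + fderiv ℝ f x v * φ x) = 0 := by
    refine (setIntegral_eq_integral_of_forall_compl_eq_zero fun x hx => ?_).trans hzero.symm
    have hx0 : x ∉ tsupport φ := fun hmem => hx (hφD hmem)
    have h0 : φ =ᶠ[𝓝 x] fun _ => 0 := notMem_tsupport_iff_eventuallyEq.1 hx0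
    rw [h0.fderiv_eq, h0.eq_of_nhds]
    simp
  have hφ2 : MemLp φ 2 (volume.restrict D) :=
    (hφ.continuous.memLp_of_hasCompactSupport hφc).restrict D
  have hφ2' : MemLp (fun x => fderiv ℝ φ x v) 2 (volume.restrict D) :=
    ((((hφ.continuous_fderiv (by simp)).clm_apply continuous_const)).memLp_of_hasCompactSupport
      (hφc.fderiv_apply ℝ v)).restrict D
  have hsplit := integral_add (h.memLp.integrable_mul hφ2') ((h.memLp_fderiv v).integrable_mul hφ2)
  simp only [Pi.mul_apply] at hsplit
  linarith

theorem memH1 : MemH1 D f :=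
  ⟨h.memLp, fun i => ⟨fun x => fderiv ℝ f x (EuclideanSpace.single i 1), h.memLp_fderiv _,
    fun _ hφ hφc hφD => h.integral_mul_fderiv hφ hφc hφD _⟩⟩

end IsPiecewisePolynomial

end Sobolev
end NitscheHybrid
namespace NitscheHybrid

/-! ### Conformity, overlap count and local estimates -/

section Estimate

open MeasureTheory

variable {n : ℕ} {D : Set (EuclideanSpace ℝ (Fin n))} {Th TH : Triangulation n}

/-- A pair of finite element functions that agree on the interface is in `H¹`. -/
theorem memH1_glue (hmesh : IsHybridMesh D Th TH) {r : ℕ} (w : Th.lagrange r × TH.lagrange r)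
    (hw : ∀ x ∈ interface D Th, (w.1 : EuclideanSpace ℝ (Fin n) → ℝ) x =
      (w.2 : EuclideanSpace ℝ (Fin n) → ℝ) x) :
    MemH1 D (glue Th (w.1 : EuclideanSpace ℝ (Fin n) → ℝ) w.2) := by
  choose! p _ hpe using w.1.2.2.1
  choose! q _ hqe using w.2.2.2.1
  refine IsPiecewisePolynomial.memH1 (ι := Th.cells ⊕ TH.cells)
    (A := Sum.elim Subtype.val Subtype.val) (p := Sum.elim (fun s => p s.1) fun s => q s.1)
    ⟨hmesh.isOpen, fun x hx => ?_, ?_⟩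
  · by_cases h : x ∈ Th.support
    · obtain ⟨s, hs, hxs⟩ := Set.mem_iUnion₂.1 h
      exact Set.mem_iUnion.2 ⟨Sum.inl ⟨s, hs⟩, hxs⟩
    · have hx' : x ∈ TH.support := hmesh.closure_diff ▸ subset_closure ⟨hx, h⟩
      obtain ⟨s, hs, hxs⟩ := Set.mem_iUnion₂.1 hx'
      exact Set.mem_iUnion.2 ⟨Sum.inr ⟨s, hs⟩, hxs⟩
  · rintro (⟨s, hs⟩ | ⟨s, hs⟩) x ⟨hxD, hxs⟩
    · simp only [glue, if_pos (hull_subset_support Th hs hxs)]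
      exact hpe s hs x hxs
    · refine Eq.trans ?_ (hqe s hs x hxs)
      by_cases h : x ∈ Th.support
      · simp only [glue, if_pos h]
        -- A point of `D` in both meshes is on the interface: it is a limit of points of `D` outside
        -- the fine region, hence not interior to it, and an open set contains none of its frontier.
        refine hw x ⟨⟨subset_closure h, fun hint => ?_⟩, fun hfr => ?_⟩
        · have hcl : x ∈ closure (D \ Th.support) :=
            hmesh.closure_diff ▸ hull_subset_support TH hs hxs
          obtain ⟨y, hy, hyD⟩ := mem_closure_iff.1 hcl _ isOpen_interior hint
          exact hyD.2 (interior_subset hy)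
        · rw [hmesh.isOpen.frontier_eq] at hfr
          exact hfr.2 hxD
      · simp only [glue, if_neg h]

/-- The part of the interface covered by the fine interface faces. -/
def faceUnion (T : Triangulation n) (Γ : Set (EuclideanSpace ℝ (Fin n))) :
    Set (EuclideanSpace ℝ (Fin n)) :=
  ⋃ e ∈ T.interfaceFaces Γ, hull e

theorem memH1_conformingMap (hmesh : IsHybridMesh D Th TH) (hsub : IsSubgrid D Th TH) {r : ℕ}
    (hr : 1 ≤ r) (v : Th.lagrange r × TH.lagrange r) :
    MemH1 D (glue Th
      ((conformingMap (faceUnion Th (interface D Th)) Th TH r v).1 :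
        EuclideanSpace ℝ (Fin n) → ℝ)
      (conformingMap (faceUnion Th (interface D Th)) Th TH r v).2) := by
  refine memH1_glue hmesh _ fun x hx => ?_
  obtain ⟨e, he, hxe⟩ := Set.mem_iUnion₂.1 (hmesh.fitted_h hx)
  obtain ⟨⟨s, hs, hes, -⟩, -⟩ := mem_interfaceFaces.1 he
  obtain ⟨S, hS, heS⟩ := exists_coarse_cell_of_isSubgrid hsub he
  exact conformingMap_fst_eq hr v hs hS hes heS
    (Set.subset_biUnion_of_mem (u := fun e => hull e) he) hxe

theorem exists_face_of_mem_cutMesh (hsub : IsSubgrid D Th TH)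
    {S : Set (EuclideanSpace ℝ (Fin n))} (hS : S ∈ cutMesh D Th TH) :
    ∃ e ∈ Th.interfaceFaces (interface D Th), hull e = S := by
  classical
  rw [hsub] at hS
  exact Finset.mem_image.1 hS

theorem hull_mem_cutMesh (hsub : IsSubgrid D Th TH)
    {e : Finset (EuclideanSpace ℝ (Fin n))} (he : e ∈ Th.interfaceFaces (interface D Th)) :
    hull e ∈ cutMesh D Th TH := by
  classical
  rw [hsub]
  exact Finset.mem_image_of_mem _ he

/-- The cell of a fine interface face touches the interface. -/
theorem mem_interfaceCells_of_face (hn : 1 ≤ n) (hmesh : IsHybridMesh D Th TH)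
    {e s : Finset (EuclideanSpace ℝ (Fin n))} (he : e ∈ Th.interfaceFaces (interface D Th))
    (hs : s ∈ Th.cells) (hes : hull e ⊆ hull s) : s ∈ Th.interfaceCells (interface D Th) :=
  mem_interfaceCells.2 ⟨hs, (Th.hull_inter_nonempty hn hmesh.fitted_h he).mono
    (Set.inter_subset_inter_left _ hes)⟩

/-- The number of fine interface cells that meet a given piece of the interface is bounded. -/
theorem card_cells_meeting_le (hn : 1 ≤ n) {σ ν : ℝ} (hσ : 0 < σ) (hν : 0 < ν)
    (hmesh : IsHybridMesh D Th TH) (hreg : Th.ShapeRegular σ) (hqu : QuasiUniformNear D Th ν)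
    (hsub : IsSubgrid D Th TH) {S : Set (EuclideanSpace ℝ (Fin n))} (hS : S ∈ cutMesh D Th TH)
    {F : Finset (Finset (EuclideanSpace ℝ (Fin n)))}
    (hF : ∀ s ∈ F, s ∈ Th.interfaceCells (interface D Th) ∧ (S ∩ hull s).Nonempty) :
    (F.card : ℝ) ≤ (4 * σ / ν) ^ n := by
  set H := interfaceSize Th (interface D Th) with hH
  obtain ⟨e, he, rfl⟩ := exists_face_of_mem_cutMesh hsub hS
  obtain ⟨⟨s₀, hs₀, hes₀, -⟩, -⟩ := mem_interfaceFaces.1 he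
  have hs₀Γ := mem_interfaceCells_of_face hn hmesh he hs₀ (hull_mono hes₀)
  have hH0 : 0 < H := (size_pos hn (Th.isCell hs₀)).trans_le (size_le_interfaceSize hs₀Γ)
  obtain ⟨x, hx, -⟩ := Th.hull_inter_nonempty hn hmesh.fitted_h he
  -- All these cells lie within two cell sizes of a point of the face, and each contains a ball of
  -- radius at least $\nu h_\Gamma/(2\sigma)$. The ratio of the radii is $4\sigma/\nu$.
  have h := Th.card_mul_pow_le (F := F) (x := x) (R := 2 * H) (δ := ν * H / (2 * σ))
    (fun s hs => (mem_interfaceCells.1 (hF s hs).1).1) (by positivity) (by positivity)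
    (fun s hs => ?_) fun s hs z hz => ?_
  · have hpow : (2 * H) ^ n = (4 * σ / ν) ^ n * (ν * H / (2 * σ)) ^ n := by
      rw [← mul_pow]
      congr 1
      field_simp
      ring
    rw [hpow] at h
    exact le_of_mul_le_mul_right h (by positivity)
  · obtain ⟨c, ρ, -, hball, hsize⟩ := hreg s (mem_interfaceCells.1 (hF s hs).1).1
    refine ⟨c, (Metric.closedBall_subset_closedBall ?_).trans hball⟩
    rw [div_le_iff₀ (by positivity)]
    have h1 : ν * H ≤ size s := hqu s (hF s hs).1
    linarith
  · obtain ⟨y, hye, hys⟩ := (hF s hs).2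
    have h1 := dist_le_size hz hys
    have h2 := dist_le_size (hull_mono hes₀ hye) (hull_mono hes₀ hx)
    have h3 : size s ≤ H := size_le_interfaceSize (hF s hs).1
    have h4 : size s₀ ≤ H := size_le_interfaceSize hs₀Γ
    have h5 := dist_triangle z y x
    rw [Metric.mem_closedBall]
    linarith

theorem abs_bary_linear_le_of_quasiUniform (hn : 1 ≤ n) {σ ν : ℝ} (hσ : 0 < σ) (hν : 0 < ν)
    (hreg : Th.ShapeRegular σ) (hqu : QuasiUniformNear D Th ν)
    {s : Finset (EuclideanSpace ℝ (Fin n))} (hs : s ∈ Th.interfaceCells (interface D Th))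
    {v : EuclideanSpace ℝ (Fin n)} (hv : v ∈ s) (u : EuclideanSpace ℝ (Fin n)) :
    |(bary s v).linear u| ≤ σ / (ν * interfaceSize Th (interface D Th)) * ‖u‖ := by
  have hsc := (mem_interfaceCells.1 hs).1
  obtain ⟨c, ρ, hρ, hball, hsize⟩ := hreg s hsc
  have hpos := size_pos hn (Th.isCell hsc)
  have hH0 : 0 < interfaceSize Th (interface D Th) := hpos.trans_le (size_le_interfaceSize hs)
  refine (abs_bary_linear_le_of_shapeRegular (Th.isCell hsc) hv hρ hball hsize hpos u).trans ?_
  gcongr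
  exact hqu s hs

open Classical in
/-- The pieces of the interface mesh that meet a given simplex. -/
noncomputable def cutMeshNear (D : Set (EuclideanSpace ℝ (Fin n))) (Th TH : Triangulation n)
    (s : Finset (EuclideanSpace ℝ (Fin n))) : Finset (Set (EuclideanSpace ℝ (Fin n))) :=
  (cutMesh D Th TH).filter fun S => (S ∩ hull s).Nonempty

/-- The nodal values of the jump in an interface cell are bounded by the jump on nearby faces. -/
theorem exists_jumpValues_sq_le (hn : 1 ≤ n) {r : ℕ} (hr : 1 ≤ r) :
    ∃ C : ℝ, 0 < C ∧ ∀ {σ ν : ℝ}, 0 < σ → 0 < ν →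
      ∀ {D : Set (EuclideanSpace ℝ (Fin n))} {Th TH : Triangulation n},
      IsHybridMesh D Th TH → Th.ShapeRegular σ → QuasiUniformNear D Th ν → IsSubgrid D Th TH →
      ∀ (v : Th.lagrange r × TH.lagrange r), ∀ s ∈ Th.interfaceCells (interface D Th),
      ∀ α ∈ latticeIndices s r,
        jumpValues (faceUnion Th (interface D Th)) Th TH r v α ^ 2 ≤
          C * (σ / (ν * interfaceSize Th (interface D Th))) ^ (n - 1) *
            ∑ S ∈ cutMeshNear D Th TH s,
              ∫ x in S, ((v.1 : EuclideanSpace ℝ (Fin n) → ℝ) x -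
                (v.2 : EuclideanSpace ℝ (Fin n) → ℝ) x) ^ 2 ∂μHE[n - 1] := by
  classical
  obtain ⟨C, hC, hface⟩ := exists_sq_eval_le_integral_face (n := n) (n - 1) hr
  refine ⟨C, hC, fun {σ ν} hσ hν {D Th TH} hmesh hreg hqu hsub v τ hτ α hα => ?_⟩
  have hH0 : 0 < interfaceSize Th (interface D Th) :=
    (size_pos hn (Th.isCell (mem_interfaceCells.1 hτ).1)).trans_le (size_le_interfaceSize hτ)
  have hI0 : ∀ S : Set (EuclideanSpace ℝ (Fin n)),
      0 ≤ ∫ x in S, ((v.1 : EuclideanSpace ℝ (Fin n) → ℝ) x -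
        (v.2 : EuclideanSpace ℝ (Fin n) → ℝ) x) ^ 2 ∂μHE[n - 1] :=
    fun S => integral_nonneg fun x => sq_nonneg _
  by_cases hA : nodePoint r α ∈ faceUnion Th (interface D Th)
  · obtain ⟨e, he, hxe⟩ := Set.mem_iUnion₂.1 hA
    obtain ⟨⟨s, hs, hes, hcard⟩, -⟩ := mem_interfaceFaces.1 he
    obtain ⟨S, hS, heS⟩ := exists_coarse_cell_of_isSubgrid hsub he
    obtain ⟨p, hp, hpe⟩ := exists_mvPolynomial_jump v hs hS (hull_mono hes) heS
    have hsΓ := mem_interfaceCells_of_face hn hmesh he hs (hull_mono hes)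
    have hval : jumpValues (faceUnion Th (interface D Th)) Th TH r v α =
        MvPolynomial.eval (fun i => nodePoint r α i) p :=
      (if_pos hA).trans (hpe _ hxe)
    -- The face carrying the node may belong to another cell, but it meets `τ` at the node itself,
    -- so it is among the nearby pieces.
    have hmem : hull e ∈ cutMeshNear D Th TH τ :=
      Finset.mem_filter.2 ⟨hull_mem_cutMesh hsub he, _, hxe, nodePoint_mem_hull hr hα⟩
    rw [hval]
    refine (hface (Th.isCell hs) hes (by omega) (by positivity)
      (fun v hv u => abs_bary_linear_le_of_quasiUniform hn hσ hν hreg hqu hsΓ (hes hv) u)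
      hp _ hxe).trans (mul_le_mul_of_nonneg_left ?_ (by positivity))
    rw [← setIntegral_congr_fun (isClosed_hull e).measurableSet
      fun x hx => congrArg (· ^ 2) (hpe x hx)]
    exact Finset.single_le_sum (f := fun S => ∫ x in S,
      ((v.1 : EuclideanSpace ℝ (Fin n) → ℝ) x - (v.2 : EuclideanSpace ℝ (Fin n) → ℝ) x) ^ 2
        ∂μHE[n - 1]) (fun S _ => hI0 S) hmem
  · have hval : jumpValues (faceUnion Th (interface D Th)) Th TH r v α = 0 := if_neg hA
    rw [hval, sq, mul_zero]
    have := Finset.sum_nonneg fun S (_ : S ∈ cutMeshNear D Th TH τ) => hI0 S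
    positivity

/-- The weighted seminorm of a polynomial on a shape regular simplex is bounded by its nodal
values. -/
theorem exists_size_zpow_mul_seminormSq_le (hn : 1 ≤ n) {r : ℕ} (hr : 1 ≤ r) {σ : ℝ}
    (hσ : 0 < σ) : ∃ C : ℝ, 0 < C ∧ ∀ {T : Triangulation n}, T.ShapeRegular σ →
      ∀ s ∈ T.cells, ∀ (c : (EuclideanSpace ℝ (Fin n) →₀ ℕ) → ℝ) (Q : ℝ),
      (∀ α ∈ latticeIndices s r, c α ^ 2 ≤ Q) → ∀ m ≤ r,
        size s ^ (2 * (m : ℤ) - 2) * seminormSq m s (nodalExt T r c) ≤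
          C * Q * (size s ^ n / size s ^ 2) := by
  obtain ⟨N, hN⟩ : ∃ N : ℝ, N = ((n + 1 + r - 1).choose r : ℕ) := ⟨_, rfl⟩
  set κ := volume.real (Metric.ball (0 : EuclideanSpace ℝ (Fin n)) 1) with hκ
  have hκ0 : 0 ≤ κ := measureReal_nonneg
  have hN0 : 0 ≤ N := hN ▸ Nat.cast_nonneg _
  -- Here `n ^ r` counts derivatives, `N * r ^ r` comes from the nodal expansion, and `κ` is the
  -- volume of the unit ball. The power of `1 + r * σ` dominates that of `r * σ` for all `m ≤ r`,
  -- also when `r * σ < 1`.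
  refine ⟨(n : ℝ) ^ r * (N * (r : ℝ) ^ r) ^ 2 * ((1 + r * σ) ^ r) ^ 2 * κ + 1, by positivity, ?_⟩
  intro T hreg s hs c Q hQ m hm
  obtain ⟨c₀, ρ, hρ, hball, hsize⟩ := hreg s hs
  have hpos := size_pos hn (T.isCell hs)
  obtain ⟨h, hh⟩ : ∃ h, h = size s := ⟨_, rfl⟩
  rw [← hh] at hpos
  have hQ0 : 0 ≤ Q := by
    obtain ⟨v, hv⟩ : s.Nonempty := Finset.card_pos.1 (by rw [(T.isCell hs).1]; omega)
    classical
    refine (sq_nonneg _).trans (hQ (Finsupp.single v r) ?_)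
    rw [mem_latticeIndices]
    refine ⟨by simp [Finsupp.single_apply, hv], ?_⟩
    exact Finsupp.support_single_subset.trans (by simpa using hv)
  have hder : ∀ x ∈ hull s, ‖iteratedFDeriv ℝ m (cellExt r s c) x‖ ≤
      N * (√Q * (r : ℝ) ^ r) * (r * (σ / h)) ^ m := fun x hx => by
    rw [hN]
    exact norm_iteratedFDeriv_cellExt_le (T.isCell hs) hr (by positivity)
      (fun v hv u => hh ▸ abs_bary_linear_le_of_shapeRegular (T.isCell hs) hv hρ hball hsize
        (hh ▸ hpos) u)
      (fun α hα => Real.abs_le_sqrt (hQ α hα)) m hx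
  have hsn := seminormSq_le (fun x hx => nodalExt_eq_cellExt T r c hs hx) hder
  have hvol := measureReal_hull_le s
  rw [← hh, ← hκ] at hvol
  rw [← hh]
  have hzpow : h ^ (2 * (m : ℤ) - 2) = h ^ (2 * m) / h ^ 2 := by
    rw [zpow_sub₀ hpos.ne']
    norm_cast
  rw [hzpow]
  have hn1 : (1 : ℝ) ≤ n := by exact_mod_cast hn
  have hb1 : ((r * σ) ^ m) ^ 2 ≤ ((1 + r * σ) ^ r) ^ 2 := by
    refine pow_le_pow_left₀ (by positivity) ?_ 2
    calc (r * σ) ^ m ≤ (1 + r * σ) ^ m := by gcongr; linarith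
      _ ≤ (1 + r * σ) ^ r :=
        pow_le_pow_right₀ (le_add_of_nonneg_right (by positivity)) hm
  calc h ^ (2 * m) / h ^ 2 * seminormSq m s (nodalExt T r c)
      ≤ h ^ (2 * m) / h ^ 2 * ((n : ℝ) ^ m * ((N * (√Q * (r : ℝ) ^ r) * (r * (σ / h)) ^ m) ^ 2 *
        (h ^ n * κ))) := by
        refine mul_le_mul_of_nonneg_left (hsn.trans ?_) (by positivity)
        exact mul_le_mul_of_nonneg_left (mul_le_mul_of_nonneg_left hvol (sq_nonneg _))
          (by positivity)
    _ = ((n : ℝ) ^ m * (N * (r : ℝ) ^ r) ^ 2 * ((r * σ) ^ m) ^ 2 * κ) * Q * (h ^ n / h ^ 2) := by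
        have hsq : √Q ^ 2 = Q := Real.sq_sqrt hQ0
        have h2 : ((r * (σ / h)) ^ m) ^ 2 = ((r * σ) ^ m) ^ 2 / h ^ (2 * m) := by
          rw [← mul_div_assoc, div_pow, div_pow, ← pow_mul h, mul_comm m 2]
        have h3 : (N * (√Q * (r : ℝ) ^ r) * (r * (σ / h)) ^ m) ^ 2 =
            (N * (r : ℝ) ^ r) ^ 2 * Q * (((r * σ) ^ m) ^ 2 / h ^ (2 * m)) := by
          rw [← h2, mul_pow, mul_pow N, mul_pow √Q, hsq]; ring
        rw [h3]
        have : h ^ (2 * m) ≠ 0 := by positivity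
        field_simp
    _ ≤ ((n : ℝ) ^ r * (N * (r : ℝ) ^ r) ^ 2 * ((1 + r * σ) ^ r) ^ 2 * κ + 1) * Q *
        (h ^ n / h ^ 2) := by
        refine mul_le_mul_of_nonneg_right (mul_le_mul_of_nonneg_right ?_ hQ0) (by positivity)
        refine le_trans ?_ (le_add_of_nonneg_right zero_le_one)
        gcongr

end Estimate
end NitscheHybrid

/-! ### Assembly of the global estimate -/

theorem lemma4p1 (n : ℕ) (hn : n = 2 ∨ n = 3) (r : ℕ) (hr : 1 ≤ r)
    (σ ν : ℝ) (hσ : 0 < σ) (hν : 0 < ν) :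
    ∃ C : ℝ, 0 < C ∧
      ∀ (D : Set (EuclideanSpace ℝ (Fin n))) (Th TH : NitscheHybrid.Triangulation n),
        NitscheHybrid.IsHybridMesh D Th TH →
        Th.ShapeRegular σ → TH.ShapeRegular σ →
        NitscheHybrid.QuasiUniformNear D Th ν →
        NitscheHybrid.IsSubgrid D Th TH →
        ∃ E : (Th.lagrange r × TH.lagrange r) →ₗ[ℝ] (Th.lagrange r × TH.lagrange r),
          (∀ v, NitscheHybrid.MemH1 D
            (NitscheHybrid.glue Th ((E v).1 : EuclideanSpace ℝ (Fin n) → ℝ) (E v).2)) ∧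
          ∀ v, ∀ m ≤ r,
            (∑ s ∈ Th.interfaceCells (NitscheHybrid.interface D Th),
                NitscheHybrid.size s ^ (2 * (m : ℤ) - 2) *
                  NitscheHybrid.seminormSq m s
                    (fun x => (v.1 : EuclideanSpace ℝ (Fin n) → ℝ) x -
                      ((E v).1 : EuclideanSpace ℝ (Fin n) → ℝ) x)) +
              (∑ s ∈ TH.interfaceCells (NitscheHybrid.interface D Th),
                NitscheHybrid.size s ^ (2 * (m : ℤ) - 2) *
                  NitscheHybrid.seminormSq m s
                    (fun x => (v.2 : EuclideanSpace ℝ (Fin n) → ℝ) x -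
                      ((E v).2 : EuclideanSpace ℝ (Fin n) → ℝ) x)) ≤
            C * ∑ e ∈ NitscheHybrid.cutMesh D Th TH,
              (NitscheHybrid.adjacentSize Th e)⁻¹ *
                ∫ x in e, ((v.1 : EuclideanSpace ℝ (Fin n) → ℝ) x -
                  (v.2 : EuclideanSpace ℝ (Fin n) → ℝ) x) ^ 2
                  ∂(MeasureTheory.Measure.euclideanHausdorffMeasure (n - 1)) := by
  classical
  open NitscheHybrid MeasureTheory in
  have hn2 : 2 ≤ n := by omega
  have hn1 : 1 ≤ n := by omega
  obtain ⟨C₁, hC₁, hjump⟩ := exists_jumpValues_sq_le (n := n) hn1 hr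
  obtain ⟨C₂, hC₂, hcell⟩ := exists_size_zpow_mul_seminormSq_le (n := n) hn1 hr hσ
  -- The inverse estimate, the face bound with its gradient factor, and the overlap count, in this
  -- order.
  refine ⟨C₂ * C₁ * (σ / ν) ^ (n - 1) * (4 * σ / ν) ^ n, by positivity, ?_⟩
  intro D Th TH hmesh hregh _ hqu hsub
  refine ⟨conformingMap (faceUnion Th (interface D Th)) Th TH r,
    memH1_conformingMap hmesh hsub hr, fun v m hm => ?_⟩
  set H := interfaceSize Th (interface D Th) with hH
  let I : Set (EuclideanSpace ℝ (Fin n)) → ℝ := fun S =>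
    ∫ x in S, ((v.1 : EuclideanSpace ℝ (Fin n) → ℝ) x -
      (v.2 : EuclideanSpace ℝ (Fin n) → ℝ) x) ^ 2 ∂μHE[n - 1]
  have hI0 : ∀ S, 0 ≤ I S := fun S => integral_nonneg fun x => sq_nonneg _
  have hadj : ∀ S ∈ cutMesh D Th TH, 0 < adjacentSize Th S ∧ adjacentSize Th S ≤ H := by
    intro S hS
    obtain ⟨e, he, rfl⟩ := exists_face_of_mem_cutMesh hsub hS
    obtain ⟨⟨s, hs, hes, -⟩, -⟩ := mem_interfaceFaces.1 he
    exact adjacentSize_pos_and_le hn1 (Th.hull_inter_nonempty hn1 hmesh.fitted_h he) hs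
      (hull_mono hes)
  have hcoarse : ∑ s ∈ TH.interfaceCells (interface D Th), size s ^ (2 * (m : ℤ) - 2) *
      seminormSq m s (fun x => (v.2 : EuclideanSpace ℝ (Fin n) → ℝ) x -
        ((conformingMap (faceUnion Th (interface D Th)) Th TH r v).2 :
          EuclideanSpace ℝ (Fin n) → ℝ) x) ≤ 0 := by
    refine Finset.sum_nonpos fun s _ => mul_nonpos_of_nonneg_of_nonpos
      (zpow_nonneg (size_nonneg s) _) ?_
    refine (seminormSq_le (f := 0) (M := 0) (fun x _ => ?_) fun x _ => ?_).trans (by simp)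
    · simp [conformingMap_snd]
    · simp
  have hfine : ∀ s ∈ Th.interfaceCells (interface D Th), size s ^ (2 * (m : ℤ) - 2) *
      seminormSq m s (fun x => (v.1 : EuclideanSpace ℝ (Fin n) → ℝ) x -
        ((conformingMap (faceUnion Th (interface D Th)) Th TH r v).1 :
          EuclideanSpace ℝ (Fin n) → ℝ) x) ≤
      C₂ * C₁ * (σ / ν) ^ (n - 1) *
        ∑ S ∈ cutMeshNear D Th TH s, (adjacentSize Th S)⁻¹ * I S := by
    intro s hs
    have hsc := (mem_interfaceCells.1 hs).1
    have hpos := size_pos hn1 (Th.isCell hsc)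
    have hsH : size s ≤ H := size_le_interfaceSize hs
    have hH0 : 0 < H := hpos.trans_le hsH
    have hfun : (fun x => (v.1 : EuclideanSpace ℝ (Fin n) → ℝ) x -
        ((conformingMap (faceUnion Th (interface D Th)) Th TH r v).1 :
          EuclideanSpace ℝ (Fin n) → ℝ) x) =
        nodalExt Th r (jumpValues (faceUnion Th (interface D Th)) Th TH r v) := by
      ext x
      rw [conformingMap_fst_apply, sub_sub_cancel]
    rw [hfun]
    refine (hcell hregh s hsc _ _ (hjump hσ hν hmesh hregh hqu hsub v s hs) m hm).trans ?_
    -- Since $h_e\le h_\Gamma$, the weight $h_e^{-1}$ can be inserted at the cost of a factor `H`.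
    have hsum : ∑ S ∈ cutMeshNear D Th TH s, I S ≤
        H * ∑ S ∈ cutMeshNear D Th TH s, (adjacentSize Th S)⁻¹ * I S := by
      rw [Finset.mul_sum]
      refine Finset.sum_le_sum fun S hS => ?_
      obtain ⟨h0, h1⟩ := hadj S (Finset.mem_filter.1 hS).1
      rw [← mul_assoc]
      refine le_mul_of_one_le_left (hI0 S) ?_
      rw [← div_eq_mul_inv]
      exact (one_le_div h0).2 h1
    have hsum0 : 0 ≤ ∑ S ∈ cutMeshNear D Th TH s, I S := Finset.sum_nonneg fun S _ => hI0 S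
    -- The condition `2 ≤ n` makes this power monotone in the size. Together with `H` from the
    -- inserted weight it cancels the `H ^ (n - 1)` in the denominator of the face bound.
    have hpow : size s ^ n / size s ^ 2 ≤ H ^ (n - 2) := by
      have : n = n - 2 + 2 := by omega
      rw [div_le_iff₀ (by positivity)]
      calc size s ^ n = size s ^ (n - 2) * size s ^ 2 := by rw [← pow_add, ← this]
        _ ≤ H ^ (n - 2) * size s ^ 2 := by gcongr
    calc C₂ * (C₁ * (σ / (ν * H)) ^ (n - 1) * ∑ S ∈ cutMeshNear D Th TH s, I S) *
          (size s ^ n / size s ^ 2)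
        ≤ C₂ * (C₁ * (σ / (ν * H)) ^ (n - 1) *
          (H * ∑ S ∈ cutMeshNear D Th TH s, (adjacentSize Th S)⁻¹ * I S)) * H ^ (n - 2) := by
          gcongr
          exact mul_nonneg hC₂.le (mul_nonneg (by positivity) (hsum0.trans hsum))
      _ = C₂ * C₁ * (σ / ν) ^ (n - 1) *
        ∑ S ∈ cutMeshNear D Th TH s, (adjacentSize Th S)⁻¹ * I S := by
          have h1 : n - 1 = n - 2 + 1 := by omega
          have h2 : (σ / (ν * H)) ^ (n - 1) * (H ^ (n - 2) * H) = (σ / ν) ^ (n - 1) := by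
            rw [← pow_succ, ← h1, ← mul_pow]
            congr 1
            field_simp
          rw [← h2]
          ring
  refine (add_le_of_nonpos_right hcoarse).trans ?_
  refine (Finset.sum_le_sum hfine).trans ?_
  rw [← Finset.mul_sum, mul_assoc (C₂ * C₁ * (σ / ν) ^ (n - 1))]
  refine mul_le_mul_of_nonneg_left ?_ (by positivity)
  simp only [cutMeshNear, Finset.sum_filter]
  -- After exchanging the sums, each piece is counted once for every fine interface cell it meets,
  -- which the packing bound controls.
  rw [Finset.sum_comm, Finset.mul_sum]
  refine Finset.sum_le_sum fun S hS => ?_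
  rw [← Finset.sum_filter, Finset.sum_const, nsmul_eq_mul]
  refine mul_le_mul_of_nonneg_right ?_ (mul_nonneg (inv_nonneg.2 (hadj S hS).1.le) (hI0 S))
  exact card_cells_meeting_le hn1 hσ hν hmesh hregh hqu hsub hS fun s hs => Finset.mem_filter.1 hs
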